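/- Let $s\in(0,1)$ and let $\Lambda^{-s}$ be the Fourier multiplier operator $\Lambda^{-s}f=\mathscr F^{-1}\big((1+\xi^2)^{-s/2}\,\mathscr F f\big)$ on tempered distributions on $\mathbb R$, where $(\mathscr F f)(\xi)=\int_{\mathbb R}f(x)e^{-ix\xi}\,dx$ for Schwartz functions $f$. For $\mu\in\mathbb R$, a solution of the steady fKdV equation with wave speed $\mu$ is a bounded continuous function $\varphi:\mathbb R\to\mathbb R$ satisfying $$-\mu\varphi+\tfrac12\varphi^2+\Lambda^{-s}\varphi=0\quad\text{on }\mathbb R .$$ Let $P\in(0,\infty]$, and let $\varphi$ be an even and nonconstant solution with $\varphi\le\mu$ on $\mathbb R$ and $\varphi(0)=\mu$, which is nondecreasing on $(-P/2,0)$ and, if $P<\infty$, $P$-periodic. Then $\varphi\in C^{0,s}(\mathbb R)$, that is, $\varphi$ is bounded and uniformly continuous and $$\sup_{x\neq y}\frac{|\varphi(x)-\varphi(y)|}{|x-y|^{s}}<\infty .$$ Moreover, there are constants $c,C,\delta>0$ such that $$c|x|^s\le\mu-\varphi(x)\le C|x|^s\qquad\text{for all }|x|<\delta .$$ In particular, $\varphi$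 is exactly $s$-Hölder regular at $0$: for no $\beta>s$ are there constants $C',\delta'>0$ with $|\varphi(x)-\varphi(0)|\le C'|x|^{\beta}$ for all $|x|<\delta'$. -/

import Mathlib

open MeasureTheory TemperedDistribution
open scoped SchwartzMap ENNReal BoundedContinuousFunction

namespace SteadyFKdV

noncomputable section

/-- A bounded continuous real function is an essentially bounded complex-valued function. -/
theorem memLp_top (f : ℝ →ᵇ ℝ) : MemLp (fun x : ℝ => (f x : ℂ)) ∞ volume :=
  memLp_top_of_bound (Complex.continuous_ofReal.comp f.continuous).aestronglyMeasurable ‖f‖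
    (Filter.Eventually.of_forall fun x => by
      simpa using f.norm_coe_le_norm x)

/-- The tempered distribution `u ↦ ∫ u(x) f(x) dx` given by a bounded continuous function `f`. -/
def toDistribution (f : ℝ →ᵇ ℝ) : 𝓢'(ℝ, ℂ) :=
  Lp.toTemperedDistribution ((memLp_top f).toLp (fun x : ℝ => (f x : ℂ)))

theorem toDistribution_apply (f : ℝ →ᵇ ℝ) (u : 𝓢(ℝ, ℂ)) :
    toDistribution f u = ∫ x : ℝ, u x * (f x : ℂ) := by
  rw [toDistribution, Lp.toTemperedDistribution_apply]
  refine integral_congr_ae ?_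
  filter_upwards [(memLp_top f).coeFn_toLp] with x hx
  rw [hx, smul_eq_mul]

/-- The symbol `⟨k⟩ ^ r = (1 + k ^ 2) ^ (r / 2)` at the angular frequency `k = 2 π ξ`.  Mathlib's
Fourier transform is `∫ f(x) exp(-2 π i x ξ) dx`, so a multiplier `m(k)` for the normalization
`∫ f(x) exp(-i x k) dx` is the multiplier `ξ ↦ m(2 π ξ)` for Mathlib's. -/
def besselSymbol (r : ℝ) (ξ : ℝ) : ℂ :=
  (((1 + (2 * Real.pi * ξ) ^ 2) ^ (r / 2) : ℝ) : ℂ)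

/-- The symbol is smooth of temperate growth, so that it does act on tempered distributions. -/
theorem besselSymbol_hasTemperateGrowth (r : ℝ) : (besselSymbol r).HasTemperateGrowth := by
  have h : (fun ξ : ℝ => ((((1 + ‖ξ‖ ^ 2) ^ (r / 2) : ℝ)) : ℂ)).HasTemperateGrowth := by
    fun_prop
  have hl : (fun ξ : ℝ => 2 * Real.pi * ξ).HasTemperateGrowth := by fun_prop
  have := h.comp hl
  convert this using 1
  funext ξ
  simp only [besselSymbol, Function.comp, Real.norm_eq_abs, sq_abs]

/-- The operator `Λ^r : f ↦ 𝓕⁻¹ (⟨k⟩ ^ r 𝓕 f)` on tempered distributions on `ℝ`. -/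
def bessel (r : ℝ) : 𝓢'(ℝ, ℂ) →L[ℂ] 𝓢'(ℝ, ℂ) :=
  fourierMultiplierCLM ℂ (besselSymbol r)

/-- `φ`, bounded and continuous, solves `-μ φ + φ ^ 2 / 2 + Λ^(-s) φ = 0` on `ℝ`, where `Λ^(-s)`
acts in the sense of distributions. -/
def IsSolution (s μ : ℝ) (φ : ℝ →ᵇ ℝ) : Prop :=
  (-μ : ℂ) • toDistribution φ + (1 / 2 : ℂ) • toDistribution (φ ^ 2)
    + bessel (-s) (toDistribution φ) = 0

/-- The interval `(-P/2, 0)` for `P ∈ [0, ∞]`; it is `(-∞, 0)` for `P = ∞`. -/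
def leftHalf (P : ℝ≥0∞) : Set ℝ :=
  {x : ℝ | x < 0 ∧ ENNReal.ofReal (-x) < P / 2}

/-- `P`-periodicity for `P ∈ (0, ∞]`; it is no condition for `P = ∞`. -/
def IsPeriodic (P : ℝ≥0∞) (f : ℝ → ℝ) : Prop :=
  P ≠ ∞ → Function.Periodic f P.toReal

/-- The Hölder space `C^{0,α}(ℝ)`, `α ∈ (0, 1)`: bounded uniformly continuous functions with
finite Hölder seminorm. -/
def MemHolderSpace (α : ℝ) (f : ℝ → ℝ) : Prop :=
  UniformContinuous f ∧ (∃ M : ℝ, ∀ x, |f x| ≤ M) ∧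
    ∃ C : ℝ, ∀ x y, |f x - f y| ≤ C * |x - y| ^ α

/-- `f` is Hölder continuous of exponent `β` at the point `a`. -/
def IsHolderAt (β : ℝ) (f : ℝ → ℝ) (a : ℝ) : Prop :=
  ∃ C : ℝ, ∃ δ > 0, ∀ x, |x - a| < δ → |f x - f a| ≤ C * |x - a| ^ β

end

end SteadyFKdV

/-! Put w = μ - φ and T = Λ^(-s). Since T fixes constants, completing the square turns the equation
into w(x)² = 2 (Tw(x) - Tw(0)) with w even, w ≥ 0 and w(0) = 0. If w has size |x|^s near the crest,
smoothing by T gains a further factor |x|^s, so both sides have order 2s. The proof makes this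
balance quantitative in both directions.

The kernel K of T is a superposition of exponentials exp(-u|x|), u ≥ 1, against a positive measure
ν. Hence K is even and decreasing on (0, ∞), K(x) = O(|x|^(s-1)), and its mixed second differences
factor under the integral into products of hyperbolic sines: they are positive and O(x h y^(s-3))
far away. This yields |Tf(x+h) - Tf(x-h)| ≤ C (A x^s + B) h^s for even f with |f| ≤ A|y|^s + B
(`exists_abs_expOp_sub_le`).

Upper bound: insert the best constant A in w ≤ A(|x|^s + η) into the equation; this gives A² ≤ 2CA,
uniformly in η (`IsCrestDefect.exists_le_rpow`).

Lower bound: D(y) = w(y+t) - w(y-t) is odd and, by monotonicity, nonnegative on the half period. On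
odd functions each exponential acts through a positive Dirichlet Green kernel, and the frequencies u
of order 1/t alone give TD ≥ c t^(s-1) ∫ D at scale t. Since (w(x+t) + w(x-t)) D(x) = 2 TD(x),
integrating over x and cancelling ∫ D gives w(3t) ≥ c t^s (`IsCrestDefect.exists_le_map_three_mul`).
If ∫ D = 0, then w vanishes near 0 and hence everywhere.

Hölder bound: divide the difference of the equations at m+h and m-h by w(m+h) + w(m-h), which the
lower bound controls from below (`IsCrestDefect.exists_abs_sub_le`). -/

namespace SteadyFKdV

/-- `ν` represents the Bessel kernel of order `s` as a superposition of exponentials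
`∫ exp (-u |x|) dν(u)`. -/
structure IsBesselMeasure (s : ℝ) (ν : Measure ℝ) : Prop where
  one_le : ∀ᵐ u ∂ν, 1 ≤ u
  integrable_resolvent : ∀ k : ℝ, Integrable (fun u => 2 * u / (u ^ 2 + k ^ 2)) ν
  integral_resolvent : ∀ k : ℝ, ∫ u, 2 * u / (u ^ 2 + k ^ 2) ∂ν = (1 + k ^ 2) ^ (-s / 2)
  integrable_exp : ∀ x : ℝ, 0 < x → Integrable (fun u => Real.exp (-(u * x))) ν
  exists_integral_exp_le : ∃ C > 0, ∀ x : ℝ, 0 < x →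
    ∫ u, Real.exp (-(u * x)) ∂ν ≤ C * x ^ (s - 1)
  exists_le_measureReal : ∃ c > 0, ∀ t : ℝ, 0 < t → t ≤ 1 →
    c * t ^ (s - 1) ≤ ν.real (Set.Icc (1 / t) (2 / t))

/-! ### The representing measure of the Bessel kernel -/

section BesselMeasure

/-- The density of `besselMeasure` in the variable `t = u ^ 2 - 1`. -/
noncomputable def besselDensity (s t : ℝ) : ℝ :=
  (∫ t in Set.Ioi 0, Real.rpowIntegrand₀₁ (1 - s / 2) t 1)⁻¹ * (t ^ (-(s / 2)) / (2 * √(1 + t)))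

/-- The measure on `(1, ∞)` representing the Bessel kernel as a superposition of exponentials. -/
noncomputable def besselMeasure (s : ℝ) : Measure ℝ :=
  ((volume.restrict (Set.Ioi 0)).withDensity fun t => ENNReal.ofReal (besselDensity s t)).map
    fun t => √(1 + t)

instance (s : ℝ) : SFinite (besselMeasure s) := by
  unfold besselMeasure; infer_instance

theorem measurable_besselDensity (s : ℝ) : Measurable (besselDensity s) := by
  unfold besselDensity; fun_prop

variable {s : ℝ}

theorem besselConst_pos (hs0 : 0 < s) (hs1 : s < 1) :
    0 < (∫ t in Set.Ioi 0, Real.rpowIntegrand₀₁ (1 - s / 2) t 1)⁻¹ :=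
  inv_pos.2 (Real.integral_rpowIntegrand₀₁_one_pos ⟨by linarith, by linarith⟩)

theorem besselDensity_nonneg (hs0 : 0 < s) (hs1 : s < 1) {t : ℝ} (ht : 0 < t) :
    0 ≤ besselDensity s t := by
  have := (besselConst_pos hs0 hs1).le
  unfold besselDensity
  positivity

theorem integrable_besselMeasure_iff (hs0 : 0 < s) (hs1 : s < 1) {g : ℝ → ℝ} (hg : Measurable g) :
    Integrable g (besselMeasure s) ↔
      IntegrableOn (fun t => besselDensity s t * g (√(1 + t))) (Set.Ioi 0) := by
  rw [besselMeasure, integrable_map_measure hg.aestronglyMeasurable (by fun_prop),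
    integrable_withDensity_iff_integrable_smul' (measurable_besselDensity s).ennreal_ofReal
      (by simp)]
  refine integrable_congr ?_
  filter_upwards [ae_restrict_mem measurableSet_Ioi] with t ht
  simp [ENNReal.toReal_ofReal (besselDensity_nonneg hs0 hs1 ht)]

theorem integral_besselMeasure (hs0 : 0 < s) (hs1 : s < 1) {g : ℝ → ℝ} (hg : Measurable g) :
    ∫ u, g u ∂(besselMeasure s) = ∫ t in Set.Ioi 0, besselDensity s t * g (√(1 + t)) := by
  rw [besselMeasure, integral_map (by fun_prop) hg.aestronglyMeasurable,
    integral_withDensity_eq_integral_toReal_smul (measurable_besselDensity s).ennreal_ofReal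
      (by simp)]
  refine integral_congr_ae ?_
  filter_upwards [ae_restrict_mem measurableSet_Ioi] with t ht
  simp [ENNReal.toReal_ofReal (besselDensity_nonneg hs0 hs1 ht)]

/-- With u² = 1 + t the resolvent is 2u / (t + λ), λ = 1 + k², and the density cancels 2u. What
remains is the integrand of the integral representation of λ^(1 - s/2), divided by λ; its integral
is therefore λ^(-s/2). -/
theorem besselDensity_mul_resolvent (hs0 : 0 < s) (hs1 : s < 1) (k : ℝ) {t : ℝ} (ht : 0 < t) :
    besselDensity s t * (2 * √(1 + t) / (√(1 + t) ^ 2 + k ^ 2)) =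
      (∫ t in Set.Ioi 0, Real.rpowIntegrand₀₁ (1 - s / 2) t 1)⁻¹ * (1 + k ^ 2)⁻¹ *
        Real.rpowIntegrand₀₁ (1 - s / 2) t (1 + k ^ 2) := by
  rw [Real.rpowIntegrand₀₁_eq_pow_div ⟨by linarith, by linarith⟩ ht.le (by positivity),
    besselDensity, Real.sq_sqrt (by linarith), show 1 - s / 2 - 1 = -(s / 2) by ring]
  have : √(1 + t) ≠ 0 := by positivity
  have h1 : 1 + k ^ 2 ≠ 0 := by positivity
  have h2 : 1 + t + k ^ 2 ≠ 0 := by positivity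
  have h3 : t + (1 + k ^ 2) ≠ 0 := by positivity
  rw [show t + (1 + k ^ 2) = 1 + t + k ^ 2 by ring]
  field_simp

/-- Replacing √(1 + t) by √t in the denominator and in the exponent leaves a Gamma integral, whose
scaling in x is exactly x^(s-1). -/
theorem besselDensity_mul_exp_le (hs0 : 0 < s) (hs1 : s < 1) {x t : ℝ} (hx : 0 < x) (ht : 0 < t) :
    besselDensity s t * Real.exp (-(√(1 + t) * x)) ≤
      (∫ t in Set.Ioi 0, Real.rpowIntegrand₀₁ (1 - s / 2) t 1)⁻¹ *
        (t ^ (-(s + 1) / 2) * Real.exp (-x * t ^ (1 / 2 : ℝ))) := by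
  have hc := (besselConst_pos hs0 hs1).le
  have hle : √t ≤ √(1 + t) := Real.sqrt_le_sqrt (by linarith)
  have ht' : 0 < √t := by positivity
  rw [besselDensity, mul_assoc]
  refine mul_le_mul_of_nonneg_left ?_ hc
  rw [← Real.sqrt_eq_rpow, show -(s + 1) / 2 = -(s / 2) - 1 / 2 by ring, Real.rpow_sub ht,
    ← Real.sqrt_eq_rpow]
  gcongr
  · linarith
  · nlinarith

theorem isBesselMeasure_besselMeasure (hs0 : 0 < s) (hs1 : s < 1) :
    IsBesselMeasure s (besselMeasure s) := by
  have hp : 1 - s / 2 ∈ Set.Ioo (0 : ℝ) 1 := ⟨by linarith, by linarith⟩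
  have hc := besselConst_pos hs0 hs1
  have hexp : ∀ x : ℝ, 0 < x → IntegrableOn
      (fun t : ℝ => t ^ (-(s + 1) / 2) * Real.exp (-x * t ^ (1 / 2 : ℝ))) (Set.Ioi 0) := by
    intro x hx
    -- A nonintegrable function has Bochner integral 0, whereas the Gamma formula gives a positive
    -- value.
    by_contra h
    have h1 := integral_rpow_mul_exp_neg_mul_rpow (p := 1 / 2) (q := -(s + 1) / 2) (b := x)
      (by norm_num) (by linarith) hx
    rw [integral_undef h] at h1
    have : 0 < Real.Gamma ((-(s + 1) / 2 + 1) / (1 / 2)) := Real.Gamma_pos_of_pos (by linarith)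
    have h2 : 0 < x ^ (-(-(s + 1) / 2 + 1) / (1 / 2)) := Real.rpow_pos_of_pos hx _
    have : 0 < x ^ (-(-(s + 1) / 2 + 1) / (1 / 2)) * (1 / (1 / 2)) *
      Real.Gamma ((-(s + 1) / 2 + 1) / (1 / 2)) := by positivity
    linarith
  have hexpInt : ∀ x : ℝ, 0 < x → Integrable (fun u => Real.exp (-(u * x))) (besselMeasure s) := by
    intro x hx
    rw [integrable_besselMeasure_iff hs0 hs1 (by fun_prop)]
    refine Integrable.mono' ((hexp x hx).const_mul
      (∫ t in Set.Ioi 0, Real.rpowIntegrand₀₁ (1 - s / 2) t 1)⁻¹)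
      ((measurable_besselDensity s).mul (by fun_prop)).aestronglyMeasurable ?_
    filter_upwards [ae_restrict_mem measurableSet_Ioi] with t ht
    rw [Real.norm_of_nonneg (mul_nonneg (besselDensity_nonneg hs0 hs1 ht) (Real.exp_pos _).le)]
    exact besselDensity_mul_exp_le hs0 hs1 hx ht
  refine ⟨?_, ?_, ?_, hexpInt, ?_, ?_⟩
  · rw [besselMeasure, ae_map_iff (by fun_prop) measurableSet_Ici]
    refine (withDensity_absolutelyContinuous _ _).ae_le ?_
    filter_upwards [ae_restrict_mem measurableSet_Ioi] with t ht
    exact Real.one_le_sqrt.2 (by linarith [Set.mem_Ioi.1 ht])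
  · intro k
    rw [integrable_besselMeasure_iff hs0 hs1 (by fun_prop)]
    refine IntegrableOn.congr_fun ?_
      (fun t ht => (besselDensity_mul_resolvent hs0 hs1 k ht).symm) measurableSet_Ioi
    exact (Real.integrableOn_rpowIntegrand₀₁_Ioi hp (by positivity)).const_mul _
  · intro k
    rw [integral_besselMeasure hs0 hs1 (by fun_prop), setIntegral_congr_fun measurableSet_Ioi
      (fun t ht => besselDensity_mul_resolvent hs0 hs1 k ht), integral_const_mul]
    have h := Real.rpow_eq_const_mul_integral hp (show (0 : ℝ) ≤ 1 + k ^ 2 by positivity)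
    have hk : 0 < 1 + k ^ 2 := by positivity
    rw [mul_right_comm, ← h, ← Real.rpow_neg_one (1 + k ^ 2), ← Real.rpow_add hk]
    ring_nf
  · refine ⟨(∫ t in Set.Ioi 0, Real.rpowIntegrand₀₁ (1 - s / 2) t 1)⁻¹ *
      (2 * Real.Gamma (1 - s)), mul_pos hc (mul_pos two_pos (Real.Gamma_pos_of_pos (by linarith))),
      fun x hx => ?_⟩
    rw [integral_besselMeasure hs0 hs1 (by fun_prop)]
    have h1 := integral_rpow_mul_exp_neg_mul_rpow (p := 1 / 2) (q := -(s + 1) / 2) (b := x)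
      (by norm_num) (by linarith) hx
    refine (setIntegral_mono_on ((integrable_besselMeasure_iff hs0 hs1 (by fun_prop)).1
      (hexpInt x hx)) ((hexp x hx).const_mul _) measurableSet_Ioi
      (fun t ht => besselDensity_mul_exp_le hs0 hs1 hx ht)).trans ?_
    rw [integral_const_mul, h1, show -(-(s + 1) / 2 + 1) / (1 / 2) = s - 1 by ring,
      show (-(s + 1) / 2 + 1) / (1 / 2) = 1 - s by ring]
    apply le_of_eq; ring
  · set c := (∫ t in Set.Ioi 0, Real.rpowIntegrand₀₁ (1 - s / 2) t 1)⁻¹ with hcdef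
    refine ⟨c * (2 ^ (-(s / 2)) / 4), by positivity, fun t ht ht1 => ?_⟩
    -- Finiteness matters because `Measure.real` is 0 on sets of infinite measure.
    have hfin : besselMeasure s (Set.Icc (1 / t) (2 / t)) ≠ ∞ := by
      have h := (hexpInt 1 one_pos).measure_ge_lt_top (ε := Real.exp (-(2 / t))) (Real.exp_pos _)
      refine ne_top_of_le_ne_top h.ne (measure_mono fun u hu => ?_)
      simpa using hu.2
    refine (ENNReal.ofReal_le_iff_le_toReal hfin).1 ?_
    rw [besselMeasure, Measure.map_apply (by fun_prop) measurableSet_Icc,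
      withDensity_apply _ (by measurability)]
    have hpow : (2 / t ^ 2 : ℝ) ^ (-(s / 2)) = 2 ^ (-(s / 2)) * t ^ s := by
      rw [Real.div_rpow (by norm_num) (by positivity), ← Real.rpow_natCast t 2,
        ← Real.rpow_mul ht.le, div_eq_mul_inv, ← Real.rpow_neg ht.le]
      congr 2; push_cast; ring
    -- For t ≤ 1 these τ satisfy √(1 + τ) ∈ [1/t, 2/t]. The density there is at least a constant
    -- times t^(s+1), and the interval has length t^(-2), so the mass is of order t^(s-1).
    have hle : ∀ τ ∈ Set.Icc (1 / t ^ 2) (2 / t ^ 2),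
        ENNReal.ofReal (c * (2 ^ (-(s / 2)) / 4) * t ^ (s + 1)) ≤
          ENNReal.ofReal (besselDensity s τ) := by
      intro τ hτ
      have hτ0 : 0 < τ := lt_of_lt_of_le (by positivity) hτ.1
      have h1 : (2 / t ^ 2 : ℝ) ^ (-(s / 2)) ≤ τ ^ (-(s / 2)) :=
        Real.rpow_le_rpow_of_nonpos hτ0 hτ.2 (by linarith)
      have h2 : √(1 + τ) ≤ 2 / t := by
        rw [Real.sqrt_le_left (by positivity), div_pow]
        have : (1 : ℝ) ≤ 1 / t ^ 2 := by
          rw [le_div_iff₀ (by positivity)]; nlinarith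
        have := hτ.2
        have e : (2 ^ 2 / t ^ 2 : ℝ) = 2 / t ^ 2 + 1 / t ^ 2 + 1 / t ^ 2 := by ring
        linarith
      refine ENNReal.ofReal_le_ofReal ?_
      rw [besselDensity, ← hcdef, mul_assoc]
      refine mul_le_mul_of_nonneg_left ?_ hc.le
      rw [hpow] at h1
      rw [Real.rpow_add ht, Real.rpow_one]
      calc 2 ^ (-(s / 2)) / 4 * (t ^ s * t) = 2 ^ (-(s / 2)) * t ^ s / (2 * (2 / t)) := by
            field_simp; norm_num
        _ ≤ _ := by gcongr
    have hsub : Set.Icc (1 / t ^ 2) (2 / t ^ 2) ⊆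
        (fun t => √(1 + t)) ⁻¹' Set.Icc (1 / t) (2 / t) ∩ Set.Ioi 0 := by
      intro τ hτ
      have hτ0 : 0 < τ := lt_of_lt_of_le (by positivity) hτ.1
      refine ⟨⟨?_, ?_⟩, hτ0⟩
      · refine Real.le_sqrt_of_sq_le ?_
        rw [div_pow, one_pow]; linarith [hτ.1]
      · rw [Real.sqrt_le_left (by positivity), div_pow]
        have : (1 : ℝ) ≤ 1 / t ^ 2 := by
          rw [le_div_iff₀ (by positivity)]; nlinarith
        have := hτ.2
        have e : (2 ^ 2 / t ^ 2 : ℝ) = 2 / t ^ 2 + 1 / t ^ 2 + 1 / t ^ 2 := by ring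
        linarith
    rw [Measure.restrict_restrict (by measurability)]
    calc ENNReal.ofReal (c * (2 ^ (-(s / 2)) / 4) * t ^ (s - 1))
        = ENNReal.ofReal (c * (2 ^ (-(s / 2)) / 4) * t ^ (s + 1)) *
            volume (Set.Icc (1 / t ^ 2) (2 / t ^ 2)) := by
          rw [Real.volume_Icc, ← ENNReal.ofReal_mul (by positivity)]
          congr 1
          rw [mul_assoc _ (t ^ (s + 1)), show s + 1 = s - 1 + 2 by ring, Real.rpow_add ht]
          norm_num
          field_simp
          norm_num
      _ = ∫⁻ _ in Set.Icc (1 / t ^ 2) (2 / t ^ 2),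
            ENNReal.ofReal (c * (2 ^ (-(s / 2)) / 4) * t ^ (s + 1)) := by
          rw [setLIntegral_const]
      _ ≤ ∫⁻ τ in Set.Icc (1 / t ^ 2) (2 / t ^ 2), ENNReal.ofReal (besselDensity s τ) :=
          setLIntegral_mono' measurableSet_Icc hle
      _ ≤ _ := lintegral_mono_set hsub

end BesselMeasure

/-! ### The kernel, its first differences and its mixed second differences -/

section BesselKernel

theorem integral_Ioi_comp_add (f : ℝ → ℝ) (a d : ℝ) :
    ∫ z in Set.Ioi a, f (z + d) = ∫ z in Set.Ioi (a + d), f z := by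
  rw [← integral_indicator measurableSet_Ioi, ← integral_indicator measurableSet_Ioi,
    ← integral_add_right_eq_self ((Set.Ioi (a + d)).indicator f) d]
  refine integral_congr_ae (Filter.Eventually.of_forall fun z => ?_)
  simp [Set.indicator_apply]

theorem sinh_le_mul_exp (a : ℝ) : Real.sinh a ≤ a * Real.exp a := by
  have h1 : Real.exp (-a) = Real.exp a * Real.exp (-(2 * a)) := by
    rw [← Real.exp_add]; ring_nf
  have h2 := Real.add_one_le_exp (-(2 * a))
  have h3 := Real.exp_pos a
  rw [Real.sinh_eq, h1]
  nlinarith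

theorem sq_le_two_mul_exp {a : ℝ} (ha : 0 ≤ a) : a ^ 2 ≤ 2 * Real.exp a := by
  have := Real.quadratic_le_exp_of_nonneg ha
  nlinarith

/-- The exponential of rate `u` against a character. -/
theorem integrable_exp_abs_mul {u : ℝ} (hu : 0 < u) (k : ℝ) :
    Integrable (fun x : ℝ => (Real.exp (-(u * |x|)) : ℂ) * Complex.exp (-(k * x) * Complex.I)) ∧
    ∫ x : ℝ, (Real.exp (-(u * |x|)) : ℂ) * Complex.exp (-(k * x) * Complex.I) =
      ((2 * u / (u ^ 2 + k ^ 2) : ℝ) : ℂ) := by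
  have ha : (-u - k * Complex.I).re < 0 := by simpa
  have hb : 0 < (u - k * Complex.I).re := by simpa
  have e1 : ∀ x ∈ Set.Ioi (0 : ℝ), Complex.exp ((-u - k * Complex.I) * x) =
      (Real.exp (-(u * |x|)) : ℂ) * Complex.exp (-(k * x) * Complex.I) := by
    intro x hx
    rw [abs_of_pos hx, Complex.ofReal_exp, ← Complex.exp_add]
    congr 1; push_cast; ring
  have e2 : ∀ x ∈ Set.Iic (0 : ℝ), Complex.exp ((u - k * Complex.I) * x) =
      (Real.exp (-(u * |x|)) : ℂ) * Complex.exp (-(k * x) * Complex.I) := by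
    intro x hx
    rw [abs_of_nonpos hx, Complex.ofReal_exp, ← Complex.exp_add]
    congr 1; push_cast; ring
  have i1 := (integrableOn_exp_mul_complex_Ioi ha 0).congr_fun e1 measurableSet_Ioi
  have i2 := (integrableOn_exp_mul_complex_Iic hb 0).congr_fun e2 measurableSet_Iic
  refine ⟨?_, ?_⟩
  · rw [← integrableOn_univ, ← Set.Iic_union_Ioi (a := (0 : ℝ))]
    exact i2.union i1
  · rw [← intervalIntegral.integral_Iic_add_Ioi i2 i1, ← setIntegral_congr_fun measurableSet_Ioi e1,
      ← setIntegral_congr_fun measurableSet_Iic e2, integral_exp_mul_complex_Ioi ha,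
      integral_exp_mul_complex_Iic hb]
    have h1 : (-u - k * Complex.I : ℂ) ≠ 0 := fun h => by rw [h] at ha; simp at ha
    have h2 : (u - k * Complex.I : ℂ) ≠ 0 := fun h => by rw [h] at hb; simp at hb
    have h3 : (u ^ 2 + k ^ 2 : ℂ) ≠ 0 := by
      have : u ^ 2 + k ^ 2 ≠ 0 := by positivity
      exact_mod_cast this
    have h4 : (u ^ 2 + k ^ 2 : ℂ) = -((-u - k * Complex.I) * (u - k * Complex.I)) := by
      ring_nf; rw [Complex.I_sq]; ring
    push_cast
    simp only [mul_zero, Complex.exp_zero]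
    rw [h4] at h3 ⊢
    field_simp
    ring

theorem integrable_exp_abs {u : ℝ} (hu : 0 < u) : Integrable fun x : ℝ => Real.exp (-(u * |x|)) := by
  have h := (integrable_exp_abs_mul hu 0).1.norm
  simpa only [norm_mul, Complex.norm_real, Complex.ofReal_zero, zero_mul, neg_zero,
    Complex.exp_zero, norm_one, mul_one, Real.norm_eq_abs, Real.abs_exp] using h

theorem integral_exp_abs {u : ℝ} (hu : 0 < u) : ∫ x : ℝ, Real.exp (-(u * |x|)) = 2 / u := by
  have h := (integrable_exp_abs_mul hu 0).2
  simp only [Complex.ofReal_zero, zero_mul, neg_zero, Complex.exp_zero, mul_one] at h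
  rw [integral_complex_ofReal] at h
  have h' := Complex.ofReal_injective h
  rw [h']; field_simp; ring

/-- The superposition of exponentials represented by `ν`. -/
noncomputable def expKernel (ν : Measure ℝ) (x : ℝ) : ℝ := ∫ u, Real.exp (-(u * |x|)) ∂ν

variable {s : ℝ} {ν : Measure ℝ}

theorem expKernel_nonneg (ν : Measure ℝ) (x : ℝ) : 0 ≤ expKernel ν x :=
  integral_nonneg fun _ => (Real.exp_pos _).le

theorem expKernel_neg (ν : Measure ℝ) (x : ℝ) : expKernel ν (-x) = expKernel ν x := by
  simp [expKernel]

theorem expKernel_abs (ν : Measure ℝ) (x : ℝ) : expKernel ν |x| = expKernel ν x := by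
  simp [expKernel]

theorem expKernel_of_pos (ν : Measure ℝ) {x : ℝ} (hx : 0 < x) :
    expKernel ν x = ∫ u, Real.exp (-(u * x)) ∂ν := by
  rw [expKernel, abs_of_pos hx]

theorem IsBesselMeasure.integrable_two_div (hν : IsBesselMeasure s ν) :
    Integrable (fun u => 2 / u) ν := by
  refine (hν.integrable_resolvent 0).congr ?_
  filter_upwards [hν.one_le] with u hu
  have : u ≠ 0 := by positivity
  field_simp; ring

theorem IsBesselMeasure.ne_zero (hν : IsBesselMeasure s ν) : ν ≠ 0 := by
  rintro rfl
  have := hν.integral_resolvent 0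
  simp at this

/-- The integral in x is 2/u, the resolvent at k = 0, which is ν-integrable. This underlies the
exchanges of the integrals in u and x. -/
theorem IsBesselMeasure.integrable_prod [SFinite ν] (hν : IsBesselMeasure s ν) :
    Integrable (fun p : ℝ × ℝ => Real.exp (-(p.1 * |p.2|))) (ν.prod volume) := by
  rw [integrable_prod_iff (by fun_prop)]
  refine ⟨?_, ?_⟩
  · filter_upwards [hν.one_le] with u hu
    exact integrable_exp_abs (by linarith)
  · refine hν.integrable_two_div.congr ?_
    filter_upwards [hν.one_le] with u hu
    simp only [Real.norm_eq_abs, Real.abs_exp]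
    rw [integral_exp_abs (by linarith)]

theorem integrable_expKernel [SFinite ν] (hν : IsBesselMeasure s ν) : Integrable (expKernel ν) :=
  hν.integrable_prod.integral_prod_right

theorem integral_expKernel_mul_exp [SFinite ν] (hν : IsBesselMeasure s ν) (k : ℝ) :
    ∫ x, (expKernel ν x : ℂ) * Complex.exp (-(k * x) * Complex.I) =
      (((1 + k ^ 2) ^ (-s / 2) : ℝ) : ℂ) := by
  have hint : Integrable (Function.uncurry fun u x : ℝ =>
      (Real.exp (-(u * |x|)) : ℂ) * Complex.exp (-(k * x) * Complex.I)) (ν.prod volume) := by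
    refine hν.integrable_prod.ofReal.mul_bdd (c := 1) (f := fun p : ℝ × ℝ =>
      ((Real.exp (-(p.1 * |p.2|)) : ℝ) : ℂ)) (g := fun p : ℝ × ℝ =>
        Complex.exp (-(k * p.2) * Complex.I)) ?_ ?_
    · exact (by fun_prop : Continuous _).aestronglyMeasurable
    · refine Filter.Eventually.of_forall fun p => ?_
      have := Complex.norm_exp_ofReal_mul_I (-(k * p.2))
      push_cast at this
      exact this.le
  have h1 := integral_integral_swap hint
  rw [← hν.integral_resolvent k, ← integral_complex_ofReal]
  calc _ = ∫ x : ℝ, ∫ u, (Real.exp (-(u * |x|)) : ℂ) * Complex.exp (-(k * x) * Complex.I) ∂ν := by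
        refine integral_congr_ae (Filter.Eventually.of_forall fun x => ?_)
        simp only [expKernel]
        rw [integral_mul_const, integral_complex_ofReal]
    _ = _ := by
        rw [← h1]
        refine integral_congr_ae ?_
        filter_upwards [hν.one_le] with u hu
        exact (integrable_exp_abs_mul (by linarith) k).2

theorem integral_expKernel [SFinite ν] (hν : IsBesselMeasure s ν) : ∫ x, expKernel ν x = 1 := by
  have h := integral_expKernel_mul_exp hν 0
  simp only [Complex.ofReal_zero, zero_mul, neg_zero, Complex.exp_zero, mul_one] at h
  rw [integral_complex_ofReal] at h
  have h' := Complex.ofReal_injective h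
  rw [h']; simp

theorem expKernel_antitone (hν : IsBesselMeasure s ν) {x y : ℝ} (hx : 0 < x) (hxy : x ≤ y) :
    expKernel ν y ≤ expKernel ν x := by
  rw [expKernel_of_pos ν hx, expKernel_of_pos ν (hx.trans_le hxy)]
  refine integral_mono_ae (hν.integrable_exp y (hx.trans_le hxy)) (hν.integrable_exp x hx) ?_
  filter_upwards [hν.one_le] with u hu
  gcongr

theorem exists_expKernel_le (hν : IsBesselMeasure s ν) :
    ∃ C > 0, ∀ x : ℝ, 0 < x → expKernel ν x ≤ C * x ^ (s - 1) := by
  obtain ⟨C, hC, h⟩ := hν.exists_integral_exp_le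
  exact ⟨C, hC, fun x hx => (expKernel_of_pos ν hx).trans_le (h x hx)⟩

theorem exists_intervalIntegral_expKernel_le [SFinite ν] (hs0 : 0 < s) (hν : IsBesselMeasure s ν) :
    ∃ C > 0, ∀ h : ℝ, 0 < h → ∫ z in (-h)..h, expKernel ν z ≤ C * h ^ s := by
  obtain ⟨C, hC, hK⟩ := exists_expKernel_le hν
  refine ⟨2 * (C / s), by positivity, fun h hh => ?_⟩
  have hi : ∀ a b, IntervalIntegrable (expKernel ν) volume a b :=
    fun a b => (integrable_expKernel hν).intervalIntegrable
  have h1 : ∫ z in (0 : ℝ)..h, expKernel ν z ≤ C / s * h ^ s := by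
    calc ∫ z in (0 : ℝ)..h, expKernel ν z ≤ ∫ z in (0 : ℝ)..h, C * z ^ (s - 1) := by
          refine intervalIntegral.integral_mono_on_of_le_Ioo hh.le (hi _ _)
            ((intervalIntegral.intervalIntegrable_rpow' (by linarith)).const_mul _)
            fun z hz => hK z hz.1
      _ = C / s * h ^ s := by
          rw [intervalIntegral.integral_const_mul, integral_rpow (Or.inl (by linarith))]
          simp [Real.zero_rpow hs0.ne']
          ring
  have h2 : ∫ z in (-h)..0, expKernel ν z = ∫ z in (0 : ℝ)..h, expKernel ν z := by
    rw [← neg_zero, ← intervalIntegral.integral_comp_neg]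
    simp [expKernel_neg]
  rw [← intervalIntegral.integral_add_adjacent_intervals (hi (-h) 0) (hi 0 h), h2]
  linarith

/-- For z > 0 one has |z - h| ≤ z + h, so monotonicity fixes the sign of the difference, and the two
half-line integrals cancel except on (-h, h). -/
theorem integral_abs_expKernel_sub [SFinite ν] (hν : IsBesselMeasure s ν) {h : ℝ} (hh : 0 < h) :
    ∫ z, |expKernel ν (z + h) - expKernel ν (z - h)| = 2 * ∫ z in (-h)..h, expKernel ν z := by
  have hK := integrable_expKernel hν
  have hev : ∀ z, |expKernel ν (z + h) - expKernel ν (z - h)| =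
      (fun z => |expKernel ν (z + h) - expKernel ν (z - h)|) |z| := by
    intro z
    rcases abs_cases z with ⟨e, -⟩ | ⟨e, -⟩
    · rw [e]
    · rw [e]
      simp only
      rw [← expKernel_neg ν (-z + h), ← expKernel_neg ν (-z - h), abs_sub_comm]
      ring_nf
  rw [integral_congr_ae (Filter.Eventually.of_forall hev), integral_comp_abs (f := fun z => |expKernel ν (z + h) - expKernel ν (z - h)|)]
  congr 1
  have e1 : ∀ᵐ z ∂(volume.restrict (Set.Ioi (0 : ℝ))),
      |expKernel ν (z + h) - expKernel ν (z - h)| = expKernel ν (z + -h) - expKernel ν (z + h) := by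
    -- At z = h the kernel is evaluated at 0, where monotonicity is not available.
    have hne : ∀ᵐ z : ℝ, z ≠ h := by simp [ae_iff]
    filter_upwards [ae_restrict_mem measurableSet_Ioi, ae_restrict_of_ae hne] with z hz hzh
    have hz' : 0 < z := hz
    rw [abs_of_nonpos, ← sub_eq_add_neg]
    · ring
    · rw [sub_nonpos, ← expKernel_abs ν (z - h)]
      refine expKernel_antitone hν (abs_pos.2 (sub_ne_zero.2 hzh)) ?_
      rw [abs_le]; constructor <;> linarith
  rw [integral_congr_ae e1, integral_sub (hK.comp_add_right _).integrableOn
    (hK.comp_add_right _).integrableOn, integral_Ioi_comp_add, integral_Ioi_comp_add, zero_add,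
    zero_add, ← intervalIntegral.integral_Ioi_sub_Ioi hK.integrableOn (by linarith)]

theorem exists_integral_abs_expKernel_sub_le [SFinite ν] (hs0 : 0 < s) (hν : IsBesselMeasure s ν) :
    ∃ C > 0, ∀ h : ℝ, 0 < h →
      ∫ z, |expKernel ν (z + h) - expKernel ν (z - h)| ≤ C * h ^ s := by
  obtain ⟨C, hC, h⟩ := exists_intervalIntegral_expKernel_le hs0 hν
  refine ⟨2 * C, by positivity, fun t ht => ?_⟩
  rw [integral_abs_expKernel_sub hν ht]
  linarith [h t ht]

/-- The mixed second difference of the kernel. -/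
noncomputable def mixedDiff (ν : Measure ℝ) (x h y : ℝ) : ℝ :=
  expKernel ν (y + (x + h)) + expKernel ν (y - (x + h)) - expKernel ν (y + (x - h)) -
    expKernel ν (y - (x - h))

/-- The factorization shows at once the positivity of the mixed difference and its smallness in both
x and h. -/
theorem exp_mixedDiff (u x h y : ℝ) :
    Real.exp (-(u * (y + (x + h)))) + Real.exp (-(u * (y - (x + h)))) -
      Real.exp (-(u * (y + (x - h)))) - Real.exp (-(u * (y - (x - h)))) =
      4 * Real.exp (-(u * y)) * Real.sinh (u * x) * Real.sinh (u * h) := by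
  simp only [Real.sinh_eq, mul_add, neg_add, sub_eq_add_neg, Real.exp_add,
    Real.exp_neg, mul_neg, neg_neg]
  field_simp
  ring

theorem hasIntegral_mixedDiff (hν : IsBesselMeasure s ν) {x h y : ℝ} (hh : 0 < h) (hx : 0 < x)
    (hy : x + h < y) :
    Integrable (fun u => 4 * Real.exp (-(u * y)) * Real.sinh (u * x) * Real.sinh (u * h)) ν ∧
    mixedDiff ν x h y =
      ∫ u, 4 * Real.exp (-(u * y)) * Real.sinh (u * x) * Real.sinh (u * h) ∂ν := by
  have i1 := hν.integrable_exp (y + (x + h)) (by linarith)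
  have i2 := hν.integrable_exp (y - (x + h)) (by linarith)
  have i3 := hν.integrable_exp (y + (x - h)) (by linarith)
  have i4 := hν.integrable_exp (y - (x - h)) (by linarith)
  simp_rw [← exp_mixedDiff]
  refine ⟨((i1.add i2).sub i3).sub i4, ?_⟩
  rw [mixedDiff, expKernel_of_pos ν (by linarith), expKernel_of_pos ν (by linarith),
    expKernel_of_pos ν (by linarith), expKernel_of_pos ν (by linarith),
    integral_sub (f := fun u => Real.exp (-(u * (y + (x + h)))) +
      Real.exp (-(u * (y - (x + h)))) - Real.exp (-(u * (y + (x - h))))) ((i1.add i2).sub i3) i4,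
    integral_sub (f := fun u => Real.exp (-(u * (y + (x + h)))) +
      Real.exp (-(u * (y - (x + h))))) (i1.add i2) i3, integral_add i1 i2]

theorem mixedDiff_pos (hν : IsBesselMeasure s ν) {x h y : ℝ} (hh : 0 < h) (hx : 0 < x)
    (hy : x + h < y) : 0 < mixedDiff ν x h y := by
  obtain ⟨hi, he⟩ := hasIntegral_mixedDiff hν hh hx hy
  have hpos : ∀ᵐ u ∂ν,
      0 < 4 * Real.exp (-(u * y)) * Real.sinh (u * x) * Real.sinh (u * h) := by
    filter_upwards [hν.one_le] with u hu
    have h1 : 0 < Real.sinh (u * x) := Real.sinh_pos_iff.2 (by positivity)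
    have h2 : 0 < Real.sinh (u * h) := Real.sinh_pos_iff.2 (by positivity)
    positivity
  rw [he, integral_pos_iff_support_of_nonneg_ae (hpos.mono fun u hu => hu.le) hi]
  refine pos_iff_ne_zero.2 fun h0 => hν.ne_zero ?_
  rw [← Measure.measure_univ_eq_zero, ← h0]
  refine measure_congr ?_
  filter_upwards [hpos] with u hu
  exact propext ⟨fun _ => hu.ne', fun _ => trivial⟩

/-- The mixed difference behaves like x h K''(y), and K'' has the order y^(s-3). -/
theorem exists_mixedDiff_le (hν : IsBesselMeasure s ν) :
    ∃ C > 0, ∀ x h y : ℝ, 0 < h → h ≤ x → 4 * x ≤ y →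
      mixedDiff ν x h y ≤ C * (x * h) * y ^ (s - 3) := by
  obtain ⟨C, hC, hK⟩ := hν.exists_integral_exp_le
  refine ⟨128 * C * 4 ^ (1 - s), by positivity, fun x h y hh hx hy => ?_⟩
  have hx0 : 0 < x := hh.trans_le hx
  have hy0 : 0 < y := by linarith
  obtain ⟨hi, he⟩ := hasIntegral_mixedDiff hν hh hx0 (show x + h < y by linarith)
  rw [he]
  calc _ ≤ ∫ u, 128 * (x * h) / y ^ 2 * Real.exp (-(u * (y / 4))) ∂ν := by
        refine integral_mono_ae hi ((hν.integrable_exp _ (by positivity)).const_mul _) ?_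
        filter_upwards [hν.one_le] with u hu
        have h1 := sinh_le_mul_exp (u * x)
        have h2 := sinh_le_mul_exp (u * h)
        have h3 := sq_le_two_mul_exp (show 0 ≤ u * (y / 4) by positivity)
        have h4 : 0 ≤ Real.sinh (u * h) := Real.sinh_nonneg_iff.2 (by positivity)
        -- The sinh factors cost u² x h and exp(u(x + h)) ≤ exp(uy/2). Half of the remaining decay
        -- exp(-uy/2) absorbs u², at the price of y^(-2).
        calc 4 * Real.exp (-(u * y)) * Real.sinh (u * x) * Real.sinh (u * h)
            ≤ 4 * Real.exp (-(u * y)) * (u * x * Real.exp (u * x)) *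
              (u * h * Real.exp (u * h)) := by gcongr
          _ = 64 * (x * h) / y ^ 2 * (u * (y / 4)) ^ 2 * (Real.exp (-(u * y)) *
                Real.exp (u * x) * Real.exp (u * h)) := by field_simp; ring
          _ ≤ 64 * (x * h) / y ^ 2 * (2 * Real.exp (u * (y / 4))) * Real.exp (-(u * (y / 2))) := by
              rw [← Real.exp_add, ← Real.exp_add]
              gcongr
              nlinarith
          _ = 128 * (x * h) / y ^ 2 * (Real.exp (u * (y / 4)) * Real.exp (-(u * (y / 2)))) := by
              ring
          _ = _ := by rw [← Real.exp_add]; ring_nf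
    _ ≤ 128 * (x * h) / y ^ 2 * (C * (y / 4) ^ (s - 1)) := by
        rw [integral_const_mul]
        exact mul_le_mul_of_nonneg_left (hK _ (by positivity)) (by positivity)
    _ = _ := by
        rw [Real.div_rpow hy0.le (by norm_num), show s - 1 = -(1 - s) by ring,
          Real.rpow_neg (by norm_num : (0 : ℝ) ≤ 4), show s - 3 = -(1 - s) - (2 : ℕ) by
          push_cast; ring, Real.rpow_sub_natCast hy0.ne']
        field_simp

end BesselKernel

/-! ### From the distributional equation to a pointwise convolution equation -/

section Representation

open FourierTransform

variable {s : ℝ} {ν : Measure ℝ}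

/-- Convolution with `expKernel ν`. -/
noncomputable def expOp (ν : Measure ℝ) (f : ℝ → ℝ) (x : ℝ) : ℝ := ∫ y, expKernel ν (x - y) * f y

theorem expOp_eq_integral_sub (ν : Measure ℝ) (f : ℝ → ℝ) (x : ℝ) :
    expOp ν f x = ∫ y, expKernel ν y * f (x - y) := by
  rw [expOp, ← integral_sub_left_eq_self _ volume x]
  simp

theorem integrable_expKernel_mul [SFinite ν] (hν : IsBesselMeasure s ν) {f : ℝ → ℝ}
    (hf : Continuous f) {M : ℝ} (hM : ∀ y, |f y| ≤ M) (x : ℝ) :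
    Integrable fun y => expKernel ν (x - y) * f y :=
  ((integrable_expKernel hν).comp_sub_left x).mul_bdd (c := M) hf.aestronglyMeasurable
    (Filter.Eventually.of_forall hM)

theorem continuous_expOp [SFinite ν] (hν : IsBesselMeasure s ν) {f : ℝ → ℝ}
    (hf : Continuous f) {M : ℝ} (hM : ∀ y, |f y| ≤ M) : Continuous (expOp ν f) := by
  have hK := integrable_expKernel hν
  simp_rw [funext (expOp_eq_integral_sub ν f)]
  refine continuous_of_dominated (bound := fun y => expKernel ν y * M) ?_ ?_ (hK.mul_const M) ?_
  · intro x
    exact hK.aestronglyMeasurable.mul (by fun_prop : Continuous _).aestronglyMeasurable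
  · refine fun x => Filter.Eventually.of_forall fun y => ?_
    rw [norm_mul, Real.norm_of_nonneg (expKernel_nonneg ν y)]
    exact mul_le_mul_of_nonneg_left (hM _) (expKernel_nonneg ν y)
  · exact Filter.Eventually.of_forall fun y => by fun_prop

/-- The symbol is the Fourier transform of the kernel at k = 2πξ; writing it so and using Fubini
leaves Fourier inversion for g at x + y. -/
theorem fourier_smulLeftCLM_fourierInv [SFinite ν] (hν : IsBesselMeasure s ν) (g : 𝓢(ℝ, ℂ)) (x : ℝ) :
    𝓕 (SchwartzMap.smulLeftCLM ℂ (besselSymbol (-s)) (𝓕⁻ g)) x =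
      ∫ y, (expKernel ν y : ℂ) * g (x + y) := by
  have hK := integrable_expKernel hν
  have hm : ∀ ξ : ℝ, besselSymbol (-s) ξ = ∫ y, (expKernel ν y : ℂ) *
      Complex.exp ((-(2 * Real.pi * ξ * y) : ℝ) * Complex.I) := by
    intro ξ
    rw [besselSymbol, ← integral_expKernel_mul_exp hν]
    push_cast; rfl
  have hint : Integrable (Function.uncurry fun ξ y : ℝ =>
      Complex.exp ((-2 * Real.pi * ξ * (x + y) : ℝ) * Complex.I) *
        ((𝓕⁻ g) ξ * (expKernel ν y : ℂ))) (volume.prod volume) := by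
    refine ((𝓕⁻ g).integrable.mul_prod hK.ofReal).bdd_mul (c := 1)
      (by fun_prop : Continuous _).aestronglyMeasurable
      (Filter.Eventually.of_forall fun p => ?_)
    exact (Complex.norm_exp_ofReal_mul_I _).le
  have h1 := integral_integral_swap hint
  have h2 : ∀ z, g z = ∫ ξ, Complex.exp ((-2 * Real.pi * ξ * z : ℝ) * Complex.I) * (𝓕⁻ g) ξ := by
    intro z
    have hg : (𝓕 (𝓕⁻ g : 𝓢(ℝ, ℂ)) : 𝓢(ℝ, ℂ)) = g := by simp
    conv_lhs => rw [← hg]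
    rw [SchwartzMap.fourier_coe, Real.fourier_eq']
    refine integral_congr_ae (Filter.Eventually.of_forall fun ξ => ?_)
    simp only [RCLike.inner_apply, conj_trivial, smul_eq_mul]
    ring_nf
  rw [SchwartzMap.fourier_coe, Real.fourier_eq']
  calc _ = ∫ ξ, ∫ y, Complex.exp ((-2 * Real.pi * ξ * (x + y) : ℝ) * Complex.I) *
        ((𝓕⁻ g) ξ * (expKernel ν y : ℂ)) := by
        refine integral_congr_ae (Filter.Eventually.of_forall fun ξ => ?_)
        simp only [SchwartzMap.smulLeftCLM_apply_apply (besselSymbol_hasTemperateGrowth (-s)),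
          smul_eq_mul]
        rw [hm, ← integral_mul_const, ← integral_const_mul]
        refine integral_congr_ae (Filter.Eventually.of_forall fun y => ?_)
        simp only
        rw [show ((-2 * Real.pi * ξ * (x + y) : ℝ) : ℂ) * Complex.I =
          ((-2 * Real.pi * inner ℝ ξ x : ℝ) : ℂ) * Complex.I +
          ((-(2 * Real.pi * ξ * y) : ℝ) * Complex.I) by
            simp only [RCLike.inner_apply, conj_trivial]; push_cast; ring, Complex.exp_add]
        ring
    _ = ∫ y, ∫ ξ, Complex.exp ((-2 * Real.pi * ξ * (x + y) : ℝ) * Complex.I) *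
        ((𝓕⁻ g) ξ * (expKernel ν y : ℂ)) := h1
    _ = _ := by
        refine integral_congr_ae (Filter.Eventually.of_forall fun y => ?_)
        simp only
        rw [h2, mul_comm (expKernel ν y : ℂ), ← integral_mul_const]
        simp only [mul_assoc]

theorem bessel_toDistribution_apply [SFinite ν] (hν : IsBesselMeasure s ν) (φ : ℝ →ᵇ ℝ)
    (g : 𝓢(ℝ, ℂ)) :
    bessel (-s) (toDistribution φ) g = ∫ z, g z * (expOp ν φ z : ℂ) := by
  have hK := integrable_expKernel hν
  have hint : Integrable (Function.uncurry fun x z : ℝ =>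
      g z * (expKernel ν (x - z) : ℂ) * (φ x : ℂ)) (volume.prod volume) := by
    refine (g.integrable.convolution_integrand (ContinuousLinearMap.mul ℂ ℂ) hK.ofReal).mul_bdd
      (c := ‖φ‖) (g := fun p : ℝ × ℝ => (φ p.1 : ℂ)) ?_ (Filter.Eventually.of_forall fun p => ?_)
    · exact (by fun_prop : Continuous fun p : ℝ × ℝ => (φ p.1 : ℂ)).aestronglyMeasurable
    · simpa using φ.norm_coe_le_norm p.1
  rw [bessel, fourierMultiplierCLM_apply_apply, toDistribution_apply]
  calc _ = ∫ x, ∫ z, g z * (expKernel ν (x - z) : ℂ) * (φ x : ℂ) := by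
        refine integral_congr_ae (Filter.Eventually.of_forall fun x => ?_)
        simp only
        rw [fourier_smulLeftCLM_fourierInv hν, integral_mul_const,
          ← integral_sub_right_eq_self _ x]
        congr 2
        funext z
        rw [← expKernel_neg]
        ring_nf
    _ = _ := by
        rw [integral_integral_swap hint]
        refine integral_congr_ae (Filter.Eventually.of_forall fun z => ?_)
        simp only [expOp]
        rw [← integral_complex_ofReal, ← integral_const_mul]
        refine integral_congr_ae (Filter.Eventually.of_forall fun x => ?_)
        simp only
        rw [← expKernel_neg ν (z - x)]
        push_cast
        ring_nf

/-- Testing with smooth compactly supported functions gives the equation almost everywhere, and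
continuity of both φ and its convolution gives it everywhere. -/
theorem IsSolution.pointwise [SFinite ν] (hν : IsBesselMeasure s ν) {μ : ℝ} {φ : ℝ →ᵇ ℝ}
    (h : IsSolution s μ φ) (x : ℝ) : -μ * φ x + φ x ^ 2 / 2 + expOp ν φ x = 0 := by
  have hM : ∀ y, |φ y| ≤ ‖φ‖ := fun y => φ.norm_coe_le_norm y
  have hT := continuous_expOp hν φ.continuous hM
  have hTb : ∀ y, ‖(expOp ν φ y : ℂ)‖ ≤ ∫ z, expKernel ν z * ‖φ‖ := by
    intro y
    rw [Complex.norm_real, expOp_eq_integral_sub]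
    refine norm_integral_le_of_norm_le ((integrable_expKernel hν).mul_const _)
      (Filter.Eventually.of_forall fun z => ?_)
    rw [norm_mul, Real.norm_of_nonneg (expKernel_nonneg ν z)]
    exact mul_le_mul_of_nonneg_left (hM _) (expKernel_nonneg ν z)
  have hcont : Continuous fun x => -μ * φ x + φ x ^ 2 / 2 + expOp ν φ x := by fun_prop
  have hae : ∀ᵐ x, -μ * φ x + φ x ^ 2 / 2 + expOp ν φ x = 0 := by
    refine ae_eq_zero_of_integral_contDiff_smul_eq_zero hcont.locallyIntegrable ?_
    intro g g_smooth g_cpt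
    have hg₁ : HasCompactSupport (Complex.ofRealCLM ∘ g) := g_cpt.comp_left rfl
    have hg₂ : ContDiff ℝ (⊤ : ℕ∞) (Complex.ofRealCLM ∘ g) := by fun_prop
    have h0 := DFunLike.congr_fun h (hg₁.toSchwartzMap hg₂)
    set G := hg₁.toSchwartzMap hg₂ with hG
    have hGg : ∀ x, G x = (g x : ℂ) := fun x => rfl
    have i1 : Integrable fun x => G x * (φ x : ℂ) :=
      G.integrable.mul_bdd (c := ‖φ‖) (by fun_prop : Continuous _).aestronglyMeasurable
        (Filter.Eventually.of_forall fun x => by simpa using φ.norm_coe_le_norm x)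
    have i2 : Integrable fun x => G x * ((φ ^ 2) x : ℂ) :=
      G.integrable.mul_bdd (c := ‖φ ^ 2‖)
        (Complex.continuous_ofReal.comp (φ ^ 2).continuous).aestronglyMeasurable
        (Filter.Eventually.of_forall fun x => by
          rw [Complex.norm_real]; exact (φ ^ 2).norm_coe_le_norm x)
    have i3 : Integrable fun x => G x * (expOp ν φ x : ℂ) :=
      G.integrable.mul_bdd (by fun_prop : Continuous _).aestronglyMeasurable
        (Filter.Eventually.of_forall hTb)
    have h1 : (-μ : ℂ) * (∫ x, G x * (φ x : ℂ)) + (1 / 2 : ℂ) * (∫ x, G x * ((φ ^ 2) x : ℂ)) +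
        ∫ x, G x * (expOp ν φ x : ℂ) = 0 := by
      rw [← toDistribution_apply, ← toDistribution_apply, ← bessel_toDistribution_apply hν]
      exact h0
    rw [← integral_const_mul, ← integral_const_mul,
      ← integral_add (i1.const_mul _) (i2.const_mul _),
      ← integral_add (f := fun x => (-μ : ℂ) * (G x * (φ x : ℂ)) +
        (1 / 2 : ℂ) * (G x * ((φ ^ 2) x : ℂ))) ((i1.const_mul _).add (i2.const_mul _)) i3] at h1
    have h2 : ∫ x, ((g x • (-μ * φ x + φ x ^ 2 / 2 + expOp ν φ x) : ℝ) : ℂ) = 0 := by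
      rw [← h1]
      refine integral_congr_ae (Filter.Eventually.of_forall fun x => ?_)
      simp only [hGg, smul_eq_mul, BoundedContinuousFunction.coe_pow, Pi.pow_apply]
      push_cast
      ring
    rw [integral_complex_ofReal] at h2
    exact_mod_cast h2
  have := Continuous.ae_eq_iff_eq volume hcont continuous_const |>.1 hae
  exact congr_fun this x

end Representation

/-! ### Smoothing estimate for symmetric differences -/

section DifferenceEstimate

variable {s : ℝ} {ν : Measure ℝ}

theorem integral_eq_integral_Ioi_add_neg {g : ℝ → ℝ} (hg : Integrable g) :
    ∫ y, g y = ∫ y in Set.Ioi 0, (g y + g (-y)) := by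
  rw [integral_add hg.integrableOn hg.comp_neg.integrableOn, integral_comp_neg_Ioi, neg_zero,
    add_comm, intervalIntegral.integral_Iic_add_Ioi hg.integrableOn hg.integrableOn]

theorem integrable_mixedDiff [SFinite ν] (hν : IsBesselMeasure s ν) (x h : ℝ) :
    Integrable (mixedDiff ν x h) := by
  have hK := integrable_expKernel hν
  exact (((hK.comp_add_right _).add (hK.comp_sub_right _)).sub (hK.comp_add_right _)).sub
    (hK.comp_sub_right _)

theorem expOp_sub_eq_integral_mixedDiff [SFinite ν] (hν : IsBesselMeasure s ν) {f : ℝ → ℝ}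
    (hf : Continuous f) {M : ℝ} (hM : ∀ y, |f y| ≤ M) (hev : Function.Even f) (x h : ℝ) :
    expOp ν f (x + h) - expOp ν f (x - h) = ∫ y in Set.Ioi 0, mixedDiff ν x h y * f y := by
  have i1 := integrable_expKernel_mul hν hf hM (x + h)
  have i2 := integrable_expKernel_mul hν hf hM (x - h)
  rw [expOp, expOp, ← integral_sub i1 i2, integral_eq_integral_Ioi_add_neg
    (g := fun y => expKernel ν (x + h - y) * f y - expKernel ν (x - h - y) * f y) (i1.sub i2)]
  refine setIntegral_congr_fun measurableSet_Ioi fun y _ => ?_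
  simp only [mixedDiff, hev y]
  rw [← expKernel_neg ν (x + h - y), ← expKernel_neg ν (x - h - y),
    show -(x + h - y) = y - (x + h) by ring, show -(x - h - y) = y - (x - h) by ring,
    show x + h - -y = y + (x + h) by ring, show x - h - -y = y + (x - h) by ring]
  ring

/-- The mixed difference is a difference of two first differences of step 2h, centred at -x and x;
translation invariance makes the bound uniform in x. -/
theorem exists_integral_abs_mixedDiff_le [SFinite ν] (hs0 : 0 < s) (hν : IsBesselMeasure s ν) :
    ∃ C > 0, ∀ x h : ℝ, 0 < h → ∫ y, |mixedDiff ν x h y| ≤ C * h ^ s := by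
  obtain ⟨C, hC, hd⟩ := exists_integral_abs_expKernel_sub_le hs0 hν
  have hK := integrable_expKernel hν
  refine ⟨2 * C, by positivity, fun x h hh => ?_⟩
  have hi : Integrable fun z => |expKernel ν (z + h) - expKernel ν (z - h)| :=
    ((hK.comp_add_right h).sub (hK.comp_sub_right h)).abs
  have e1 := integral_add_right_eq_self (μ := volume)
    (fun z => |expKernel ν (z + h) - expKernel ν (z - h)|) x
  have e2 := integral_sub_right_eq_self (μ := volume)
    (fun z => |expKernel ν (z + h) - expKernel ν (z - h)|) x
  calc ∫ y, |mixedDiff ν x h y| ≤ ∫ y, (|expKernel ν (y + x + h) - expKernel ν (y + x - h)| +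
        |expKernel ν (y - x + h) - expKernel ν (y - x - h)|) := by
        refine integral_mono (integrable_mixedDiff hν x h).abs
          ((hi.comp_add_right x).add (hi.comp_sub_right x)) fun y => ?_
        simp only
        rw [abs_sub_comm (expKernel ν (y - x + h))]
        refine le_trans (le_of_eq ?_) (abs_add_le _ _)
        rw [mixedDiff, show y + (x + h) = y + x + h by ring, show y - (x + h) = y - x - h by ring,
          show y + (x - h) = y + x - h by ring, show y - (x - h) = y - x + h by ring]
        congr 1; ring
    _ ≤ 2 * C * h ^ s := by
        rw [integral_add (hi.comp_add_right x) (hi.comp_sub_right x), e1, e2]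
        linarith [hd h hh]

/-- The main difference estimate: a function growing like `A |y| ^ s + B` is mapped to one that
gains `h ^ s` over differences with step `2 h ≤ 2 x`. -/
theorem exists_abs_expOp_sub_le [SFinite ν] (hs0 : 0 < s) (hs1 : s < 1)
    (hν : IsBesselMeasure s ν) :
    ∃ C > 0, ∀ (f : ℝ → ℝ) (M A B : ℝ), Continuous f → (∀ y, |f y| ≤ M) → Function.Even f →
      0 ≤ A → 0 ≤ B → (∀ y, |f y| ≤ A * |y| ^ s + B) → ∀ x h : ℝ, 0 < h → h ≤ x →
        |expOp ν f (x + h) - expOp ν f (x - h)| ≤ C * (A * x ^ s + B) * h ^ s := by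
  obtain ⟨C₁, hC₁, hL⟩ := exists_integral_abs_mixedDiff_le hs0 hν
  obtain ⟨C₂, hC₂, hN⟩ := exists_mixedDiff_le hν
  have hs2 : 0 < 2 - 2 * s := by linarith
  refine ⟨4 * C₁ + C₂ / (2 - 2 * s), by positivity,
    fun f M A B hf hM hev hA hB hfb x h hh hx => ?_⟩
  have hx0 : 0 < x := hh.trans_le hx
  have hi := (integrable_mixedDiff hν x h).mul_bdd (c := M) hf.aestronglyMeasurable
    (Filter.Eventually.of_forall hM)
  have hE : 0 ≤ A * x ^ s + B := by positivity
  -- For y ≤ 4x the growth bound is at most 4 (A x^s + B), and the L¹ bound on the mixed difference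
  -- suffices.
  have hnear : ∫ y in Set.Ioc 0 (4 * x), |mixedDiff ν x h y * f y| ≤
      4 * C₁ * (A * x ^ s + B) * h ^ s := by
    calc _ ≤ ∫ y in Set.Ioc 0 (4 * x), 4 * (A * x ^ s + B) * |mixedDiff ν x h y| := by
          refine setIntegral_mono_on hi.abs.integrableOn
            ((integrable_mixedDiff hν x h).abs.const_mul _).integrableOn measurableSet_Ioc
            fun y hy => ?_
          rw [abs_mul, mul_comm]
          refine mul_le_mul_of_nonneg_right ((hfb y).trans ?_) (abs_nonneg _)
          have h1 : |y| ^ s ≤ 4 * x ^ s := by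
            rw [abs_of_pos hy.1]
            calc y ^ s ≤ (4 * x) ^ s := Real.rpow_le_rpow hy.1.le hy.2 hs0.le
              _ = 4 ^ s * x ^ s := Real.mul_rpow (by norm_num) hx0.le
              _ ≤ 4 ^ (1 : ℝ) * x ^ s := by gcongr; norm_num
              _ = _ := by norm_num
          nlinarith
      _ ≤ ∫ y, 4 * (A * x ^ s + B) * |mixedDiff ν x h y| :=
          setIntegral_le_integral ((integrable_mixedDiff hν x h).abs.const_mul _)
            (Filter.Eventually.of_forall fun y => by positivity)
      _ ≤ _ := by
          rw [integral_const_mul]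
          calc _ ≤ 4 * (A * x ^ s + B) * (C₁ * h ^ s) := by gcongr; exact hL x h hh
            _ = _ := by ring
  -- For y > 4x, |f y| ≤ (A x^s + B)(y/x)^s. The pointwise kernel bound leaves y^(2s-3), integrable
  -- at infinity as s < 1, and the outcome h x^(s-1) is at most h^s since h ≤ x.
  have hfar : ∫ y in Set.Ioi (4 * x), |mixedDiff ν x h y * f y| ≤
      C₂ / (2 - 2 * s) * (A * x ^ s + B) * h ^ s := by
    have hr : 2 * s - 3 < -1 := by linarith
    calc _ ≤ ∫ y in Set.Ioi (4 * x), C₂ * h * (A * x ^ s + B) * x ^ (1 - s) * y ^ (2 * s - 3) := by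
          refine setIntegral_mono_on hi.abs.integrableOn
            ((integrableOn_Ioi_rpow_of_lt hr (by positivity)).const_mul _) measurableSet_Ioi
            fun y hy => ?_
          have hy' : 4 * x < y := hy
          have hy0 : 0 < y := by linarith
          have h1 := hN x h y hh hx hy'.le
          have h2 : |f y| ≤ (A * x ^ s + B) * (y ^ s / x ^ s) := by
            refine (hfb y).trans ?_
            rw [abs_of_pos hy0, add_mul]
            have h3 : 1 ≤ y ^ s / x ^ s := by
              rw [le_div_iff₀ (by positivity), one_mul]
              exact Real.rpow_le_rpow hx0.le (by linarith) hs0.le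
            have h4 : A * x ^ s * (y ^ s / x ^ s) = A * y ^ s := by field_simp
            nlinarith
          rw [abs_mul, abs_of_pos (mixedDiff_pos hν hh hx0 (by linarith))]
          calc _ ≤ C₂ * (x * h) * y ^ (s - 3) * ((A * x ^ s + B) * (y ^ s / x ^ s)) := by gcongr
            _ = _ := by
              rw [show 2 * s - 3 = s - 3 + s by ring, Real.rpow_add hy0, Real.rpow_sub hx0,
                Real.rpow_one]
              field_simp
      _ = C₂ * h * (A * x ^ s + B) * x ^ (1 - s) * ((4 * x) ^ (2 * s - 2) / (2 - 2 * s)) := by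
          rw [integral_const_mul, integral_Ioi_rpow_of_lt hr (by positivity),
            show 2 * s - 3 + 1 = 2 * s - 2 by ring, show 2 * s - 2 = -(2 - 2 * s) by ring]
          rw [div_neg, neg_div, neg_neg]
      _ ≤ C₂ * h * (A * x ^ s + B) * x ^ (1 - s) * (x ^ (2 * s - 2) / (2 - 2 * s)) := by
          have : (4 * x) ^ (2 * s - 2) ≤ x ^ (2 * s - 2) :=
            Real.rpow_le_rpow_of_nonpos hx0 (by linarith) (by linarith)
          gcongr
      _ = C₂ / (2 - 2 * s) * (A * x ^ s + B) * (h * x ^ (s - 1)) := by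
          rw [show s - 1 = (1 - s) + (2 * s - 2) by ring, Real.rpow_add hx0]
          field_simp
      _ ≤ C₂ / (2 - 2 * s) * (A * x ^ s + B) * (h * h ^ (s - 1)) := by
          have : x ^ (s - 1) ≤ h ^ (s - 1) :=
            Real.rpow_le_rpow_of_nonpos hh hx (by linarith)
          gcongr
      _ = _ := by
          rw [Real.rpow_sub_one hh.ne']
          field_simp
  rw [expOp_sub_eq_integral_mixedDiff hν hf hM hev]
  calc _ ≤ ∫ y in Set.Ioi 0, |mixedDiff ν x h y * f y| := abs_integral_le_integral_abs
    _ = (∫ y in Set.Ioc 0 (4 * x), |mixedDiff ν x h y * f y|) +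
        ∫ y in Set.Ioi (4 * x), |mixedDiff ν x h y * f y| := by
        rw [← setIntegral_union (Set.Ioc_disjoint_Ioi le_rfl) measurableSet_Ioi
          hi.abs.integrableOn hi.abs.integrableOn, Set.Ioc_union_Ioi_eq_Ioi (by positivity)]
    _ ≤ _ := by linarith

end DifferenceEstimate

/-- The defect `w = μ - φ` of a solution touching `μ` at the origin from below. -/
structure IsCrestDefect (ν : Measure ℝ) (w : ℝ → ℝ) (M : ℝ) : Prop where
  continuous : Continuous w
  bounded : ∀ y, |w y| ≤ M
  even : Function.Even w
  nonneg : ∀ y, 0 ≤ w y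
  sq_eq : ∀ x, w x ^ 2 = 2 * (expOp ν w x - expOp ν w 0)

/-! ### Upper bound at the crest and unique continuation -/

section UpperBound

variable {s : ℝ} {ν : Measure ℝ} {w : ℝ → ℝ} {M : ℝ}

theorem IsCrestDefect.map_zero (hw : IsCrestDefect ν w M) : w 0 = 0 := by
  have := hw.sq_eq 0
  simpa using this

theorem IsCrestDefect.map_abs (hw : IsCrestDefect ν w M) (x : ℝ) : w |x| = w x := by
  rcases abs_cases x with ⟨e, -⟩ | ⟨e, -⟩
  · rw [e]
  · rw [e, hw.even]

/-- The regularization η > 0 makes the best constant A finite a priori. Since the equation is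
quadratic in w and linear in Tw, it gives A² ≤ 2CA, hence a bound independent of η, and η tends to
0. -/
theorem IsCrestDefect.exists_le_rpow [SFinite ν] (hs0 : 0 < s) (hs1 : s < 1)
    (hν : IsBesselMeasure s ν) (hw : IsCrestDefect ν w M) :
    ∃ C > 0, ∀ x, w x ≤ C * |x| ^ s := by
  obtain ⟨C, hC, hT⟩ := exists_abs_expOp_sub_le hs0 hs1 hν
  have hM : 0 ≤ M := (abs_nonneg _).trans (hw.bounded 0)
  have key : ∀ η : ℝ, 0 < η → ∀ x, w x ≤ 2 * C * (|x| ^ s + η) := by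
    intro η hη
    have hpos : ∀ y : ℝ, 0 < |y| ^ s + η := fun y => by positivity
    have hbdd : BddAbove (Set.range fun y => w y / (|y| ^ s + η)) := by
      refine ⟨M / η, ?_⟩
      rintro _ ⟨y, rfl⟩
      have h1 : 0 ≤ |y| ^ s := by positivity
      exact div_le_div₀ hM ((le_abs_self _).trans (hw.bounded y)) hη (by linarith)
    set A := ⨆ y, w y / (|y| ^ s + η) with hAdef
    have hA : ∀ y, w y ≤ A * (|y| ^ s + η) := fun y =>
      (div_le_iff₀ (hpos y)).1 (le_ciSup hbdd y)
    have hA0 : 0 ≤ A := Real.iSup_nonneg fun y => div_nonneg (hw.nonneg y) (hpos y).le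
    have hsq : ∀ x, w x ^ 2 ≤ 2 * C * A * (|x| ^ s + η) ^ 2 := by
      intro x
      rw [← hw.map_abs]
      rcases (abs_nonneg x).eq_or_lt with h0 | h0
      · rw [← h0, hw.map_zero, zero_pow two_ne_zero]; positivity
      -- Centre and step |x|/2 make the two points |x| and 0.
      · have h := hT w M A (A * η) hw.continuous hw.bounded hw.even hA0 (by positivity)
          (fun y => by rw [abs_of_nonneg (hw.nonneg y)]; linarith [hA y]) (|x| / 2) (|x| / 2)
          (by positivity) le_rfl
        rw [add_halves, sub_self] at h
        have h2 : (|x| / 2) ^ s ≤ |x| ^ s :=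
          Real.rpow_le_rpow (by positivity) (by linarith) hs0.le
        have h3 : (0 : ℝ) ≤ (|x| / 2) ^ s := by positivity
        have h4 : C * (A * (|x| / 2) ^ s + A * η) * (|x| / 2) ^ s ≤
            C * (A * |x| ^ s + A * η) * (|x| ^ s + η) := by
          gcongr
          linarith
        rw [hw.sq_eq]
        calc _ ≤ 2 * (C * (A * |x| ^ s + A * η) * (|x| ^ s + η)) := by
              linarith [le_abs_self (expOp ν w |x| - expOp ν w 0)]
          _ = _ := by ring
    have hle : A ≤ √(2 * C * A) := by
      refine ciSup_le fun y => ?_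
      rw [div_le_iff₀ (hpos y)]
      refine le_of_sq_le_sq ?_ (by have := hpos y; positivity)
      rw [mul_pow, Real.sq_sqrt (by positivity)]
      exact hsq y
    have hA2 : A ≤ 2 * C := by
      have h1 : A ^ 2 ≤ 2 * C * A := by
        rw [← Real.sq_sqrt (show 0 ≤ 2 * C * A by positivity)]
        gcongr
      by_contra! h
      nlinarith
    intro x
    exact (hA x).trans (mul_le_mul_of_nonneg_right hA2 (hpos x).le)
  refine ⟨2 * C, by positivity, fun x => le_of_forall_pos_le_add fun ε hε => ?_⟩
  have := key (ε / (2 * C)) (by positivity) x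
  rw [mul_add] at this
  rwa [mul_div_cancel₀ _ (by positivity)] at this

/-- If the defect vanishes near the crest, it vanishes identically. -/
theorem IsCrestDefect.eq_zero_of_eqOn [SFinite ν] (hν : IsBesselMeasure s ν)
    (hw : IsCrestDefect ν w M) {r : ℝ} (hr : 0 < r) (h : ∀ x, 0 ≤ x → x ≤ r → w x = 0) :
    ∀ x, w x = 0 := by
  have h1 := expOp_sub_eq_integral_mixedDiff hν hw.continuous hw.bounded hw.even (r / 2) (r / 2)
  have h2 := hw.sq_eq r
  rw [h r hr.le le_rfl] at h2
  rw [add_halves, sub_self, show expOp ν w r - expOp ν w 0 = 0 by linarith] at h1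
  -- With centre and step r/2, Tw(r) - Tw(0) = 0 is the integral of a kernel positive beyond r
  -- against w ≥ 0, which vanishes on [0, r].
  have hnn : ∀ y, r < y → 0 < mixedDiff ν (r / 2) (r / 2) y := fun y hy =>
    mixedDiff_pos hν (by positivity) (by positivity) (by linarith)
  have hi : IntegrableOn (fun y => mixedDiff ν (r / 2) (r / 2) y * w y) (Set.Ioi 0) :=
    ((integrable_mixedDiff hν _ _).mul_bdd (c := M) hw.continuous.aestronglyMeasurable
    (Filter.Eventually.of_forall hw.bounded)).integrableOn
  have h3 := (setIntegral_eq_zero_iff_of_nonneg_ae ?_ hi).1 h1.symm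
  · have h4 : w =ᵐ[volume.restrict (Set.Ioi 0)] fun _ => 0 := by
      filter_upwards [h3, ae_restrict_mem measurableSet_Ioi] with y hy hy0
      rcases le_or_gt y r with hyr | hyr
      · exact h y (le_of_lt hy0) hyr
      · exact (mul_eq_zero.1 hy).resolve_left (hnn y hyr).ne'
    have h5 := Measure.eqOn_open_of_ae_eq h4 isOpen_Ioi hw.continuous.continuousOn
      continuousOn_const
    intro x
    rw [← hw.map_abs]
    rcases (abs_nonneg x).eq_or_lt with h0 | h0
    · rw [← h0, hw.map_zero]
    · exact h5 h0
  · filter_upwards [ae_restrict_mem measurableSet_Ioi] with y hy0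
    rcases le_or_gt y r with hyr | hyr
    · simp [h y (le_of_lt hy0) hyr]
    · exact mul_nonneg (hnn y hyr).le (hw.nonneg y)

end UpperBound

/-! ### Positivity of single exponentials on odd functions -/

section GreenKernel

/-- The function `∫ exp (-u |x - y|) f(y) dy`. -/
noncomputable def expAvg (u : ℝ) (f : ℝ → ℝ) (x : ℝ) : ℝ := ∫ y, Real.exp (-(u * |x - y|)) * f y

/-- The (unnormalized) Green kernel of `u ^ 2 - d² / dx²` on the half period `(0, p / 2)` with
Dirichlet conditions, where `q = exp (-u p)`; the half-line is `q = 0`. -/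
noncomputable def greenKernel (u q x y : ℝ) : ℝ :=
  (Real.exp (u * min x y) - Real.exp (-(u * min x y))) *
    (Real.exp (-(u * max x y)) - q * Real.exp (u * max x y))

theorem continuous_greenKernel (u q x : ℝ) : Continuous (greenKernel u q x) := by
  unfold greenKernel; fun_prop

variable {u M : ℝ} {f : ℝ → ℝ}

theorem integrable_exp_abs_sub_mul (hu : 0 < u) (hf : Continuous f) (hM : ∀ y, |f y| ≤ M) (x : ℝ) :
    Integrable fun y => Real.exp (-(u * |x - y|)) * f y :=
  ((integrable_exp_abs hu).comp_sub_left x).mul_bdd (c := M) hf.aestronglyMeasurable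
    (Filter.Eventually.of_forall hM)

theorem exp_sub_exp_eq_greenKernel {x y : ℝ} (hx : 0 < x) (hy : 0 < y) :
    Real.exp (-(u * |x - y|)) - Real.exp (-(u * |x + y|)) = greenKernel u 0 x y := by
  rw [abs_of_pos (show 0 < x + y by linarith), greenKernel, zero_mul, sub_zero, sub_mul,
    ← Real.exp_add, ← Real.exp_add]
  rcases le_total x y with h | h
  · rw [min_eq_left h, max_eq_right h, abs_of_nonpos (by linarith)]
    ring_nf
  · rw [min_eq_right h, max_eq_left h, abs_of_nonneg (by linarith)]
    ring_nf

theorem integrableOn_greenKernel_zero_mul (hu : 0 < u) (hf : Continuous f) (hM : ∀ y, |f y| ≤ M)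
    {x : ℝ} (hx : 0 < x) : IntegrableOn (fun y => greenKernel u 0 x y * f y) (Set.Ioi 0) := by
  have i1 := integrable_exp_abs_sub_mul hu hf hM x
  have i2 := integrable_exp_abs_sub_mul hu hf hM (-x)
  refine (i1.sub i2).integrableOn.congr_fun (fun y hy => ?_) measurableSet_Ioi
  simp only [Pi.sub_apply]
  rw [← exp_sub_exp_eq_greenKernel hx hy, ← abs_neg (-x - y), show -(-x - y) = x + y by ring]
  ring

theorem expAvg_eq_integral_Ioi (hu : 0 < u) (hf : Continuous f) (hM : ∀ y, |f y| ≤ M)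
    (hodd : ∀ y, f (-y) = -f y) {x : ℝ} (hx : 0 < x) :
    expAvg u f x = ∫ y in Set.Ioi 0, greenKernel u 0 x y * f y := by
  rw [expAvg, integral_eq_integral_Ioi_add_neg (integrable_exp_abs_sub_mul hu hf hM x)]
  refine setIntegral_congr_fun measurableSet_Ioi fun y hy => ?_
  simp only [hodd y, sub_neg_eq_add]
  rw [← exp_sub_exp_eq_greenKernel hx hy]
  ring

theorem integrableOn_exp_mul (hu : 0 < u) (hf : Continuous f) (hM : ∀ y, |f y| ≤ M) :
    IntegrableOn (fun y => Real.exp (-(u * y)) * f y) (Set.Ioi 0) := by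
  have h := (integrable_exp_abs_sub_mul hu hf hM 0).integrableOn (s := Set.Ioi 0)
  refine h.congr_fun (fun y hy => ?_) measurableSet_Ioi
  simp only [zero_sub, abs_neg, abs_of_pos (show 0 < y from hy)]

theorem integral_Ioi_exp_mul_of_periodic {p : ℝ} (hper : Function.Periodic f p) :
    ∫ y in Set.Ioi p, Real.exp (-(u * y)) * f y =
      Real.exp (-(u * p)) * ∫ y in Set.Ioi 0, Real.exp (-(u * y)) * f y := by
  have h := integral_Ioi_comp_add (fun y => Real.exp (-(u * y)) * f y) 0 p
  rw [zero_add] at h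
  rw [← h, ← integral_const_mul]
  refine setIntegral_congr_fun measurableSet_Ioi fun y _ => ?_
  simp only [hper y]
  rw [mul_add, neg_add, Real.exp_add]
  ring

/-- Method of images: the weight over a full period minus its reflection y ↦ p - y imposes the
second Dirichlet condition, at p/2. -/
theorem greenKernel_fold {p x y : ℝ} (hxp : x ≤ p / 2) (hyp : y ≤ p / 2) :
    ((1 - Real.exp (-(u * p))) * greenKernel u 0 x y + Real.exp (-(u * p)) *
        (Real.exp (u * x) - Real.exp (-(u * x))) * Real.exp (-(u * y))) -
      ((1 - Real.exp (-(u * p))) * greenKernel u 0 x (p - y) + Real.exp (-(u * p)) *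
        (Real.exp (u * x) - Real.exp (-(u * x))) * Real.exp (-(u * (p - y)))) =
      greenKernel u (Real.exp (-(u * p))) x y := by
  have e : Real.exp (-(u * (p - y))) = Real.exp (-(u * p)) * Real.exp (u * y) := by
    rw [← Real.exp_add]; ring_nf
  simp only [greenKernel]
  rw [min_eq_left (show x ≤ p - y by linarith), max_eq_right (show x ≤ p - y by linarith), e]
  rcases le_total x y with h | h
  · rw [min_eq_left h, max_eq_right h]
    ring
  · rw [min_eq_right h, max_eq_left h]
    ring

/-- Periodicity sums the tail beyond p as a geometric series of ratio q, cleared by the factor 1 -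
q. An odd p-periodic function is odd about p/2, so the second half period folds onto the first. -/
theorem mul_expAvg_eq_integral (hu : 0 < u) (hf : Continuous f) (hM : ∀ y, |f y| ≤ M)
    (hodd : ∀ y, f (-y) = -f y) {p x : ℝ} (hper : Function.Periodic f p) (hx : 0 < x)
    (hxp : x < p / 2) :
    (1 - Real.exp (-(u * p))) * expAvg u f x =
      ∫ y in (0 : ℝ)..(p / 2), greenKernel u (Real.exp (-(u * p))) x y * f y := by
  have hp : 0 < p := by linarith
  set q := Real.exp (-(u * p)) with hq
  set J := ∫ y in Set.Ioi 0, Real.exp (-(u * y)) * f y with hJ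
  set E := Real.exp (u * x) - Real.exp (-(u * x)) with hE
  have hcG := continuous_greenKernel u 0 x
  have hiJ := integrableOn_exp_mul hu hf hM
  have hiG := integrableOn_greenKernel_zero_mul hu hf hM hx
  have hJeq : J = (∫ y in (0 : ℝ)..p, Real.exp (-(u * y)) * f y) + q * J := by
    rw [hJ, hq, ← integral_Ioi_exp_mul_of_periodic hper,
      intervalIntegral.integral_interval_add_Ioi hiJ (hiJ.mono_set (Set.Ioi_subset_Ioi hp.le))]
  have hveq : expAvg u f x = (∫ y in (0 : ℝ)..p, greenKernel u 0 x y * f y) + E * (q * J) := by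
    rw [expAvg_eq_integral_Ioi hu hf hM hodd hx, hJ, hq, ← integral_Ioi_exp_mul_of_periodic hper,
      ← integral_const_mul, ← intervalIntegral.integral_interval_add_Ioi hiG
        (hiG.mono_set (Set.Ioi_subset_Ioi hp.le))]
    congr 1
    refine setIntegral_congr_fun measurableSet_Ioi fun y hy => ?_
    have hy' : x ≤ y := by have : p < y := hy; linarith
    simp only [greenKernel, min_eq_left hy', max_eq_right hy', hE]
    ring
  have hcf : ∀ g : ℝ → ℝ, Continuous g → ∀ a b, IntervalIntegrable (fun y => g y * f y) volume a b :=
    fun g hg a b => (hg.mul hf).intervalIntegrable a b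
  set H : ℝ → ℝ := fun y => (1 - q) * greenKernel u 0 x y + q * E * Real.exp (-(u * y)) with hH
  have hHc : Continuous H := by fun_prop
  have h1 : (1 - q) * expAvg u f x = ∫ y in (0 : ℝ)..p, H y * f y := by
    have : ∫ y in (0 : ℝ)..p, H y * f y = (1 - q) * (∫ y in (0 : ℝ)..p, greenKernel u 0 x y * f y) +
        q * E * ∫ y in (0 : ℝ)..p, Real.exp (-(u * y)) * f y := by
      rw [← intervalIntegral.integral_const_mul, ← intervalIntegral.integral_const_mul,
        ← intervalIntegral.integral_add ((hcf _ hcG _ _).const_mul _)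
          ((hcf _ (by fun_prop) _ _).const_mul _)]
      congr 1; funext y; simp only [hH]; ring
    rw [this, hveq]
    linear_combination q * E * hJeq
  have h2 : ∫ y in (p / 2)..p, H y * f y = -∫ y in (0 : ℝ)..(p / 2), H (p - y) * f y := by
    have := intervalIntegral.integral_comp_sub_left (a := 0) (b := p / 2) (fun y => H y * f y) p
    rw [sub_zero, show p - p / 2 = p / 2 by ring] at this
    rw [← this, ← intervalIntegral.integral_neg]
    congr 1; funext y
    have : f (p - y) = -f y := by rw [← hodd y, ← hper (-y)]; ring_nf
    rw [this]; ring
  rw [h1, ← intervalIntegral.integral_add_adjacent_intervals (hcf H hHc 0 (p / 2))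
    (hcf H hHc (p / 2) p), h2, ← sub_eq_add_neg, ← intervalIntegral.integral_sub
    (hcf H hHc _ _) (hcf (fun y => H (p - y)) (by fun_prop) _ _)]
  refine intervalIntegral.integral_congr fun y hy => ?_
  rw [Set.uIcc_of_le (by linarith)] at hy
  rw [← greenKernel_fold hxp.le hy.2]
  simp only [hH]
  ring

theorem greenKernel_nonneg (hu : 0 < u) {q x y : ℝ} (hx : 0 < x) (hy : 0 < y)
    (hq : q * Real.exp (u * max x y) ≤ Real.exp (-(u * max x y))) : 0 ≤ greenKernel u q x y := by
  have h : 0 < min x y := lt_min hx hy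
  refine mul_nonneg (sub_nonneg.2 (Real.exp_le_exp.2 ?_)) (sub_nonneg.2 hq)
  nlinarith [mul_pos hu h]

/-- A lower bound for `greenKernel` in the scale-invariant range. -/
noncomputable def greenBound : ℝ :=
  (Real.exp 1 - Real.exp (-1)) * (Real.exp (-4) - Real.exp (-6))

theorem greenBound_pos : 0 < greenBound := by
  unfold greenBound
  have h1 : Real.exp (-1) < Real.exp 1 := Real.exp_lt_exp.2 (by norm_num)
  have h2 : Real.exp (-6) < Real.exp (-4) := Real.exp_lt_exp.2 (by norm_num)
  exact mul_pos (by linarith) (by linarith)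

/-- In this range u min(x, y) ≥ 1 and u max(x, y) ≤ 4. The image term is at most exp(-10) exp(4) =
exp(-6), below the main term exp(-4). -/
theorem greenBound_le {q t x y : ℝ} (ht : 0 < t) (hx : x ∈ Set.Icc t (2 * t))
    (hy : y ∈ Set.Icc t (2 * t)) (hu : u ∈ Set.Icc (1 / t) (2 / t)) (hq : q ≤ Real.exp (-10)) :
    greenBound ≤ greenKernel u q x y := by
  have hu0 : 0 < u := lt_of_lt_of_le (by positivity) hu.1
  have h1 : 1 ≤ u * min x y := by
    calc (1 : ℝ) = 1 / t * t := by field_simp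
      _ ≤ u * min x y := mul_le_mul hu.1 (le_min hx.1 hy.1) ht.le hu0.le
  have h2 : u * max x y ≤ 4 := by
    have hm : 0 ≤ max x y := (ht.le.trans hx.1).trans (le_max_left _ _)
    calc u * max x y ≤ 2 / t * (2 * t) :=
          mul_le_mul hu.2 (max_le hx.2 hy.2) hm (by positivity)
      _ = 4 := by field_simp; norm_num
  have h3 : Real.exp (-6) = Real.exp (-10) * Real.exp 4 := by rw [← Real.exp_add]; norm_num
  have h4 : Real.exp (-6) < Real.exp (-4) := Real.exp_lt_exp.2 (by norm_num)
  have h5 : Real.exp (-1) < Real.exp 1 := Real.exp_lt_exp.2 (by norm_num)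
  have h6 : q * Real.exp (u * max x y) ≤ Real.exp (-10) * Real.exp 4 := by gcongr
  have h7 : Real.exp 1 ≤ Real.exp (u * min x y) := Real.exp_le_exp.2 h1
  have h8 : Real.exp (-(u * min x y)) ≤ Real.exp (-1) := Real.exp_le_exp.2 (by linarith)
  have h9 : Real.exp (-4) ≤ Real.exp (-(u * max x y)) := Real.exp_le_exp.2 (by linarith)
  unfold greenBound greenKernel
  exact mul_le_mul (by linarith) (by linarith) (by linarith) (by linarith)

/-- For odd `f`, nonnegative on the half period, `expAvg u f` is bounded below by a multiple of the
integral of `f` at scale `t`, for frequencies `u` of order `1 / t`. -/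
theorem expAvg_lower_bound (hf : Continuous f) (hM : ∀ y, |f y| ≤ M)
    (hodd : ∀ y, f (-y) = -f y) {t : ℝ} (ht : 0 < t)
    (hpos : (∀ y, 0 < y → 0 ≤ f y) ∨ ∃ p, 10 * t ≤ p ∧ Function.Periodic f p ∧
      ∀ y, 0 < y → y < p / 2 → 0 ≤ f y)
    {x : ℝ} (hx : x ∈ Set.Icc t (2 * t)) (hu : 0 < u) :
    0 ≤ expAvg u f x ∧ (u ∈ Set.Icc (1 / t) (2 / t) →
      greenBound * (∫ y in t..(2 * t), f y) ≤ expAvg u f x) := by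
  have hx0 : 0 < x := ht.trans_le hx.1
  rw [intervalIntegral.integral_of_le (by linarith), ← integral_const_mul]
  rcases hpos with hpos | ⟨p, htp, hper, hpos⟩
  · have hg : ∀ y, 0 < y → 0 ≤ greenKernel u 0 x y := fun y hy =>
      greenKernel_nonneg hu hx0 hy (by rw [zero_mul]; positivity)
    have heq := expAvg_eq_integral_Ioi hu hf hM hodd hx0
    have hnn : ∀ y ∈ Set.Ioi (0 : ℝ), 0 ≤ greenKernel u 0 x y * f y :=
      fun y hy => mul_nonneg (hg y hy) (hpos y hy)
    refine ⟨heq ▸ setIntegral_nonneg measurableSet_Ioi hnn, fun hut => ?_⟩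
    have hi := integrableOn_greenKernel_zero_mul hu hf hM hx0
    have hsub : Set.Ioc t (2 * t) ⊆ Set.Ioi 0 := fun y hy => ht.trans hy.1
    rw [heq]
    calc _ ≤ ∫ y in Set.Ioc t (2 * t), greenKernel u 0 x y * f y := by
          refine setIntegral_mono_on
            ((by fun_prop : Continuous _).integrableOn_Ioc) (hi.mono_set hsub) measurableSet_Ioc
            fun y hy => ?_
          exact mul_le_mul_of_nonneg_right (greenBound_le ht hx ⟨hy.1.le, hy.2⟩ hut
            (Real.exp_pos _).le) (hpos y (hsub hy))
      _ ≤ _ := setIntegral_mono_set hi ((ae_restrict_mem measurableSet_Ioi).mono hnn)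
          hsub.eventuallyLE
  · have hp : 0 < p := by linarith
    have hxp : x < p / 2 := by linarith [hx.2]
    set q := Real.exp (-(u * p)) with hq
    have hq0 : 0 < q := Real.exp_pos _
    have hq1 : q < 1 := Real.exp_lt_one_iff.2 (by nlinarith [mul_pos hu hp])
    have heq := mul_expAvg_eq_integral hu hf hM hodd hper hx0 hxp
    rw [intervalIntegral.integral_of_le (by linarith), integral_Ioc_eq_integral_Ioo] at heq
    have hnn : ∀ y ∈ Set.Ioo (0 : ℝ) (p / 2), 0 ≤ greenKernel u q x y * f y := by
      intro y hy
      refine mul_nonneg (greenKernel_nonneg hu hx0 hy.1 ?_) (hpos y hy.1 hy.2)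
      rw [hq, ← Real.exp_add]
      refine Real.exp_le_exp.2 ?_
      have : max x y ≤ p / 2 := max_le hxp.le hy.2.le
      nlinarith
    have h0 : 0 ≤ (1 - q) * expAvg u f x := heq ▸ setIntegral_nonneg measurableSet_Ioo hnn
    have h1 : 0 ≤ expAvg u f x := nonneg_of_mul_nonneg_right h0 (by linarith)
    refine ⟨h1, fun hut => ?_⟩
    have hi : IntegrableOn (fun y => greenKernel u q x y * f y) (Set.Ioo 0 (p / 2)) :=
      ((continuous_greenKernel u q x).mul hf).integrableOn_Icc.mono_set Set.Ioo_subset_Icc_self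
    have hsub : Set.Ioc t (2 * t) ⊆ Set.Ioo 0 (p / 2) :=
      fun y hy => ⟨ht.trans hy.1, by linarith [hy.2]⟩
    -- Here p ≥ 10t enters: u ≥ 1/t gives up ≥ 10.
    have hq10 : q ≤ Real.exp (-10) := by
      refine Real.exp_le_exp.2 (neg_le_neg ?_)
      calc (10 : ℝ) = 1 / t * (10 * t) := by field_simp
        _ ≤ u * p := mul_le_mul hut.1 htp (by positivity) hu.le
    calc _ ≤ ∫ y in Set.Ioc t (2 * t), greenKernel u q x y * f y := by
          refine setIntegral_mono_on
            ((by fun_prop : Continuous _).integrableOn_Ioc) (hi.mono_set hsub) measurableSet_Ioc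
            fun y hy => ?_
          exact mul_le_mul_of_nonneg_right (greenBound_le ht hx ⟨hy.1.le, hy.2⟩ hut hq10)
            (hpos y (hsub hy).1 (hsub hy).2)
      _ ≤ ∫ y in Set.Ioo 0 (p / 2), greenKernel u q x y * f y :=
          setIntegral_mono_set hi ((ae_restrict_mem measurableSet_Ioo).mono hnn)
            hsub.eventuallyLE
      _ = (1 - q) * expAvg u f x := heq.symm
      _ ≤ expAvg u f x := by nlinarith

end GreenKernel

/-- `w` is nondecreasing on `(0, ∞)`, or periodic and nondecreasing on half a period. -/
def IsMonotoneFromCrest (w : ℝ → ℝ) : Prop :=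
  MonotoneOn w (Set.Ici 0) ∨
    ∃ p, 0 < p ∧ Function.Periodic w p ∧ MonotoneOn w (Set.Icc 0 (p / 2))

/-! ### Lower bound at the crest -/

section LowerBound

variable {s : ℝ} {ν : Measure ℝ} {w : ℝ → ℝ} {M : ℝ}

theorem expOp_eq_integral_expAvg [SFinite ν] (hν : IsBesselMeasure s ν) {f : ℝ → ℝ}
    (hf : Continuous f) (hM : ∀ y, |f y| ≤ M) (x : ℝ) :
    Integrable (fun u => expAvg u f x) ν ∧ expOp ν f x = ∫ u, expAvg u f x ∂ν := by
  have hshift : MeasurePreserving (fun p : ℝ × ℝ => (p.1, x - p.2)) (ν.prod volume)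
      (ν.prod volume) := (MeasurePreserving.id ν).prod (Measure.measurePreserving_sub_left volume x)
  have hint : Integrable (Function.uncurry fun u y : ℝ => Real.exp (-(u * |x - y|)) * f y)
      (ν.prod volume) :=
    (hshift.integrable_comp_of_integrable hν.integrable_prod).mul_bdd (c := M)
      (g := fun p : ℝ × ℝ => f p.2) (by fun_prop : Continuous _).aestronglyMeasurable
      (Filter.Eventually.of_forall fun p => hM p.2)
  refine ⟨hint.integral_prod_left, ?_⟩
  have h := integral_integral_swap hint
  simp only [expAvg]
  rw [h, expOp]
  refine integral_congr_ae (Filter.Eventually.of_forall fun y => ?_)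
  simp only [expKernel]
  rw [integral_mul_const]

/-- All frequencies contribute nonnegatively, so only those in [1/t, 2/t] are kept; their ν-mass is
at least a multiple of t^(s-1). -/
theorem exists_expOp_lower_bound [SFinite ν] (hν : IsBesselMeasure s ν) :
    ∃ c > 0, ∀ (f : ℝ → ℝ) (M t : ℝ), Continuous f → (∀ y, |f y| ≤ M) → (∀ y, f (-y) = -f y) →
      0 < t → t ≤ 1 → ((∀ y, 0 < y → 0 ≤ f y) ∨ ∃ p, 10 * t ≤ p ∧ Function.Periodic f p ∧
        ∀ y, 0 < y → y < p / 2 → 0 ≤ f y) →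
      ∀ x ∈ Set.Icc t (2 * t), c * t ^ (s - 1) * (∫ y in t..(2 * t), f y) ≤ expOp ν f x := by
  obtain ⟨c, hc, hmass⟩ := hν.exists_le_measureReal
  refine ⟨greenBound * c, mul_pos greenBound_pos hc, fun f M t hf hM hodd ht ht1 hpos x hx => ?_⟩
  obtain ⟨hi, heq⟩ := expOp_eq_integral_expAvg hν hf hM x
  have hlow := fun (u : ℝ) (hu : 1 ≤ u) => expAvg_lower_bound hf hM hodd ht hpos hx (by linarith : 0 < u)
  set I := ∫ y in t..(2 * t), f y with hI
  have hI0 : 0 ≤ I := by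
    refine intervalIntegral.integral_nonneg (by linarith) fun y hy => ?_
    rcases hpos with hpos | ⟨p, htp, -, hpos⟩
    · exact hpos y (ht.trans_le hy.1)
    · exact hpos y (ht.trans_le hy.1) (by linarith [hy.2])
  have hm := hmass t ht ht1
  have hfin : ν (Set.Icc (1 / t) (2 / t)) ≠ ∞ := by
    intro htop
    rw [measureReal_def, htop] at hm
    have : 0 < c * t ^ (s - 1) := by positivity
    simp at hm
    linarith
  rw [heq]
  calc greenBound * c * t ^ (s - 1) * I = greenBound * I * (c * t ^ (s - 1)) := by ring
    _ ≤ greenBound * I * ν.real (Set.Icc (1 / t) (2 / t)) :=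
        mul_le_mul_of_nonneg_left hm (mul_nonneg greenBound_pos.le hI0)
    _ = ∫ _ in Set.Icc (1 / t) (2 / t), greenBound * I ∂ν := by
        rw [setIntegral_const, smul_eq_mul, mul_comm]
    _ ≤ ∫ u in Set.Icc (1 / t) (2 / t), expAvg u f x ∂ν := by
        refine setIntegral_mono_on (integrableOn_const hfin) hi.integrableOn measurableSet_Icc
          fun u hu => (hlow u ?_).2 hu
        exact le_trans (by rw [le_div_iff₀ ht]; linarith) hu.1
    _ ≤ ∫ u, expAvg u f x ∂ν := by
        refine setIntegral_le_integral hi ?_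
        filter_upwards [hν.one_le] with u hu
        exact (hlow u hu).1

theorem expOp_translate_sub [SFinite ν] (hν : IsBesselMeasure s ν) (hw : Continuous w)
    (hM : ∀ y, |w y| ≤ M) (x t : ℝ) :
    expOp ν (fun y => w (y + t) - w (y - t)) x = expOp ν w (x + t) - expOp ν w (x - t) := by
  have hK := integrable_expKernel hν
  have hi : ∀ z, Integrable fun y => expKernel ν y * w (z - y) := fun z =>
    hK.mul_bdd (c := M) (by fun_prop : Continuous _).aestronglyMeasurable
      (Filter.Eventually.of_forall fun y => hM _)
  simp_rw [expOp_eq_integral_sub]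
  rw [← integral_sub (hi _) (hi _)]
  refine integral_congr_ae (Filter.Eventually.of_forall fun y => ?_)
  simp only
  rw [show x - y + t = x + t - y by ring, show x - y - t = x - t - y by ring]
  ring

theorem IsCrestDefect.monotone_difference (hw : IsCrestDefect ν w M) {t : ℝ} (ht : 0 < t)
    (hmono : MonotoneOn w (Set.Ici 0) ∨
      ∃ p, 10 * t ≤ p ∧ Function.Periodic w p ∧ MonotoneOn w (Set.Icc 0 (p / 2))) :
    (∀ y, 0 < y → 0 ≤ w (y + t) - w (y - t)) ∨
      ∃ p, 10 * t ≤ p ∧ Function.Periodic (fun y => w (y + t) - w (y - t)) p ∧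
        ∀ y, 0 < y → y < p / 2 → 0 ≤ w (y + t) - w (y - t) := by
  refine hmono.imp (fun hm y hy => ?_) ?_
  · rw [sub_nonneg, ← hw.map_abs (y - t)]
    exact hm (Set.mem_Ici.2 (abs_nonneg _)) (show 0 ≤ y + t by positivity)
      (abs_le.2 ⟨by linarith, by linarith⟩)
  · rintro ⟨p, htp, hper, hm⟩
    refine ⟨p, htp, fun y => ?_, fun y hy hyp => ?_⟩
    · simp only
      rw [add_right_comm, hper, add_sub_right_comm, hper]
    · have habs : |y - t| ≤ p / 2 := abs_le.2 ⟨by linarith, by linarith⟩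
      rw [sub_nonneg, ← hw.map_abs (y - t)]
      rcases le_or_gt (y + t) (p / 2) with h | h
      · exact hm ⟨abs_nonneg _, habs⟩ ⟨by positivity, h⟩ (abs_le.2 ⟨by linarith, by linarith⟩)
      -- Past the trough, y + t is reflected to p - (y + t), which lies in the half period and still
      -- dominates |y - t|.
      · rw [← hw.even (y + t), ← hper (-(y + t))]
        exact hm ⟨abs_nonneg _, habs⟩ ⟨by linarith, by linarith⟩
          (abs_le.2 ⟨by linarith, by linarith⟩)

/-- The quadratic estimate at scale `t`: one step of the lower bound. -/
theorem IsCrestDefect.exists_le_map_three_mul [SFinite ν] (hν : IsBesselMeasure s ν)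
    (hw : IsCrestDefect ν w M) (hne : ∃ x, w x ≠ 0) :
    ∃ c > 0, ∀ t, 0 < t → t ≤ 1 → (MonotoneOn w (Set.Ici 0) ∨
      ∃ p, 10 * t ≤ p ∧ Function.Periodic w p ∧ MonotoneOn w (Set.Icc 0 (p / 2))) →
      c * t ^ s ≤ w (3 * t) := by
  obtain ⟨c, hc, hlow⟩ := exists_expOp_lower_bound hν
  refine ⟨c, hc, fun t ht ht1 hmono => ?_⟩
  have hloc : MonotoneOn w (Set.Icc 0 (3 * t)) := by
    rcases hmono with hm | ⟨p, htp, -, hm⟩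
    · exact hm.mono Set.Icc_subset_Ici_self
    · exact hm.mono (Set.Icc_subset_Icc_right (by linarith))
  have hdiff := hw.monotone_difference ht hmono
  set D : ℝ → ℝ := fun y => w (y + t) - w (y - t) with hD
  have hwc := hw.continuous
  have hDc : Continuous D := by fun_prop
  have hDM : ∀ y, |D y| ≤ M + M := fun y =>
    (abs_sub _ _).trans (add_le_add (hw.bounded _) (hw.bounded _))
  have hDodd : ∀ y, D (-y) = -D y := by
    intro y
    simp only [hD]
    rw [← hw.even (-y + t), ← hw.even (-y - t)]
    ring_nf
  have hD0 : ∀ y ∈ Set.Icc t (2 * t), 0 ≤ D y := by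
    intro y hy
    rcases hdiff with h | ⟨p, htp, -, h⟩
    · exact h y (ht.trans_le hy.1)
    · exact h y (ht.trans_le hy.1) (by linarith [hy.2])
  set I := ∫ y in t..(2 * t), D y with hI
  have hI0 : 0 ≤ I := intervalIntegral.integral_nonneg (by linarith) hD0
  -- Subtracting the equations at x ± t gives (w(x+t) + w(x-t)) D(x) = 2 TD(x), and both values of w
  -- are at most w(3t).
  have hpt : ∀ x ∈ Set.Icc t (2 * t), c * t ^ (s - 1) * I ≤ w (3 * t) * D x := by
    intro x hx
    have h1 := hlow D (M + M) t hDc hDM hDodd ht ht1 hdiff x hx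
    rw [hD, expOp_translate_sub hν hwc hw.bounded] at h1
    have h2 : (w (x + t) + w (x - t)) * D x = 2 * (expOp ν w (x + t) - expOp ν w (x - t)) := by
      have e1 := hw.sq_eq (x + t)
      have e2 := hw.sq_eq (x - t)
      simp only [hD]
      linear_combination e1 - e2
    have h3 : w (x + t) ≤ w (3 * t) :=
      hloc ⟨by linarith [hx.1], by linarith [hx.2]⟩ ⟨by positivity, le_rfl⟩ (by linarith [hx.2])
    have h4 : w (x - t) ≤ w (3 * t) :=
      hloc ⟨by linarith [hx.1], by linarith [hx.2]⟩ ⟨by positivity, le_rfl⟩ (by linarith [hx.2])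
    have h5 := mul_le_mul_of_nonneg_right (add_le_add h3 h4) (hD0 x hx)
    linarith
  -- Integration over an interval of length t turns t^(s-1) into t^s and reproduces I on the right.
  have hint : c * t ^ s * I ≤ w (3 * t) * I := by
    have h := intervalIntegral.integral_mono_on (by linarith : t ≤ 2 * t)
      (intervalIntegrable_const (μ := volume) (c := c * t ^ (s - 1) * I))
      ((hDc.const_mul (w (3 * t))).intervalIntegrable _ _) hpt
    rw [intervalIntegral.integral_const, intervalIntegral.integral_const_mul, smul_eq_mul] at h
    refine le_trans (le_of_eq ?_) h
    rw [Real.rpow_sub_one ht.ne']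
    field_simp
    ring
  rcases hI0.eq_or_lt with h0 | h0
  -- If I = 0 then D = 0 on [t, 2t]: D(t) = 0 gives w(2t) = 0, and D(2t) = 0 gives w(3t) = w(t) ≤
  -- w(2t) = 0. Then w vanishes on [0, 3t], hence identically.
  · exfalso
    have hDz : ∀ y ∈ Set.Icc t (2 * t), D y = 0 := by
      intro y hy
      by_contra hy0
      have hpos := intervalIntegral.integral_pos (by linarith : t < 2 * t) hDc.continuousOn
        (fun z hz => hD0 z ⟨hz.1.le, hz.2⟩) ⟨y, hy, lt_of_le_of_ne (hD0 y hy) (Ne.symm hy0)⟩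
      linarith
    have h1 := hDz t ⟨le_rfl, by linarith⟩
    have h2 := hDz (2 * t) ⟨by linarith, le_rfl⟩
    simp only [hD] at h1 h2
    rw [show t + t = 2 * t by ring, sub_self, hw.map_zero] at h1
    rw [show 2 * t + t = 3 * t by ring, show 2 * t - t = t by ring] at h2
    have h3 : w t ≤ w (2 * t) :=
      hloc ⟨by linarith, by linarith⟩ ⟨by linarith, by linarith⟩ (by linarith)
    have h4 : w (3 * t) = 0 := le_antisymm (by linarith) (hw.nonneg _)
    obtain ⟨x, hx⟩ := hne
    refine hx (hw.eq_zero_of_eqOn hν (show 0 < 3 * t by positivity) (fun z hz hz3 => ?_) x)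
    refine le_antisymm ?_ (hw.nonneg z)
    rw [← h4]
    exact hloc ⟨hz, hz3⟩ ⟨by positivity, le_rfl⟩ hz3
  · exact le_of_mul_le_mul_right hint h0

theorem IsCrestDefect.exists_rpow_le [SFinite ν] (hs0 : 0 < s) (hν : IsBesselMeasure s ν)
    (hw : IsCrestDefect ν w M) (hne : ∃ x, w x ≠ 0) (hmono : IsMonotoneFromCrest w) :
    ∃ c > 0, ∃ δ > 0, ∀ x, |x| ≤ δ → c * |x| ^ s ≤ w x := by
  obtain ⟨c, hc, hstep⟩ := hw.exists_le_map_three_mul hν hne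
  obtain ⟨δ, hδ, hδ1, hδm⟩ : ∃ δ > 0, δ ≤ 1 ∧ ∀ t, t ≤ δ → (MonotoneOn w (Set.Ici 0) ∨
      ∃ p, 10 * t ≤ p ∧ Function.Periodic w p ∧ MonotoneOn w (Set.Icc 0 (p / 2))) := by
    rcases hmono with hm | ⟨p, hp, hper, hm⟩
    · exact ⟨1, one_pos, le_rfl, fun t _ => Or.inl hm⟩
    · refine ⟨min 1 (p / 10), by positivity, min_le_left _ _, fun t ht => Or.inr ⟨p, ?_, hper, hm⟩⟩
      have := ht.trans (min_le_right _ _)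
      linarith
  refine ⟨c * (1 / 3) ^ s, by positivity, 3 * δ, by positivity, fun x hx => ?_⟩
  rw [← hw.map_abs x]
  rcases (abs_nonneg x).eq_or_lt with h0 | h0
  · rw [← h0, Real.zero_rpow hs0.ne', hw.map_zero, mul_zero]
  · have h := hstep (|x| / 3) (by positivity) (by linarith) (hδm _ (by linarith))
    rw [mul_div_cancel₀ _ (by norm_num : (3 : ℝ) ≠ 0)] at h
    refine le_trans (le_of_eq ?_) h
    rw [mul_assoc, ← Real.mul_rpow (by norm_num) h0.le]
    ring_nf

end LowerBound

/-! ### Global Hölder continuity -/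

section Holder

variable {s : ℝ} {ν : Measure ℝ} {w : ℝ → ℝ} {M : ℝ}

/-- Hölder estimate for a difference whose midpoint lies where `w` is monotone from the crest. -/
theorem IsCrestDefect.exists_abs_sub_le [SFinite ν] (hs0 : 0 < s) (hs1 : s < 1)
    (hν : IsBesselMeasure s ν) (hw : IsCrestDefect ν w M) (hne : ∃ x, w x ≠ 0)
    (hmono : IsMonotoneFromCrest w) :
    ∃ C > 0, ∀ S : Set ℝ, MonotoneOn w S → (∀ x ∈ S, ∀ y, 0 ≤ y → y ≤ x → y ∈ S) →
      ∀ m ∈ S, 0 ≤ m → ∀ h, 0 < h → |w (m + h) - w (m - h)| ≤ C * h ^ s := by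
  obtain ⟨A, hA, hup⟩ := hw.exists_le_rpow hs0 hs1 hν
  obtain ⟨c, hc, δ, hδ, hlow⟩ := hw.exists_rpow_le hs0 hν hne hmono
  obtain ⟨C, hC, hT⟩ := exists_abs_expOp_sub_le hs0 hs1 hν
  have hM : 0 ≤ M := (abs_nonneg _).trans (hw.bounded 0)
  set C₁ := A * 3 ^ s with hC₁
  set C₂ := 2 * C * A * 2 ^ s / c with hC₂
  set C₃ := 2 * C * M / (c * δ ^ s) with hC₃
  have h₁ : 0 < C₁ := by positivity
  have h₂ : 0 < C₂ := by positivity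
  have h₃ : 0 ≤ C₃ := by positivity
  refine ⟨C₁ + C₂ + C₃, by positivity, fun S hS hdown m hm hm0 h hh => ?_⟩
  have hhs : 0 < h ^ s := by positivity
  rcases le_or_gt m (2 * h) with hmh | hmh
  -- Near the crest, m ≤ 2h, both points lie within 3h of 0 and the upper bound alone suffices.
  · have hb : ∀ z, |z| ≤ 3 * h → w z ≤ C₁ * h ^ s := by
      intro z hz
      calc w z ≤ A * |z| ^ s := hup z
        _ ≤ A * (3 * h) ^ s := by gcongr
        _ = _ := by rw [Real.mul_rpow (by norm_num) hh.le]; ring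
    have b1 := hb (m + h) (abs_le.2 ⟨by linarith, by linarith⟩)
    have b2 := hb (m - h) (abs_le.2 ⟨by linarith, by linarith⟩)
    have n1 := hw.nonneg (m + h)
    have n2 := hw.nonneg (m - h)
    calc _ ≤ C₁ * h ^ s := abs_le.2 ⟨by linarith, by linarith⟩
      _ ≤ _ := by gcongr; linarith
  · have hmpos : 0 < m := by linarith
    have hdiff : ∀ K, 0 < K → K ≤ w (m - h) → |w (m + h) - w (m - h)| * K ≤
        2 * |expOp ν w (m + h) - expOp ν w (m - h)| := by
      intro K hK hKw
      have e1 := hw.sq_eq (m + h)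
      have e2 := hw.sq_eq (m - h)
      have n1 := hw.nonneg (m + h)
      have n2 := hw.nonneg (m - h)
      calc _ ≤ |w (m + h) - w (m - h)| * (w (m + h) + w (m - h)) := by gcongr; linarith
        _ = |(w (m + h) - w (m - h)) * (w (m + h) + w (m - h))| := by
            rw [abs_mul, abs_of_nonneg (add_nonneg n1 n2)]
        _ = |2 * (expOp ν w (m + h) - expOp ν w (m - h))| := by
            congr 1; linear_combination e1 - e2
        _ = _ := by rw [abs_mul, abs_two]
    -- Only the nearer point m - h needs a lower bound, so m + h may leave the region of
    -- monotonicity.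
    have hge : ∀ z, 0 < z → z ≤ m - h → z ≤ δ → c * z ^ s ≤ w (m - h) := by
      intro z hz hzm hzδ
      have h1 := hlow z (by rwa [abs_of_pos hz])
      rw [abs_of_pos hz] at h1
      exact h1.trans (hS (hdown m hm z hz.le (by linarith))
        (hdown m hm (m - h) (by linarith) (by linarith)) hzm)
    -- Since m > 2h, m/2 ≤ m - h. If m/2 ≤ δ, the factor m^s from the smoothing estimate cancels
    -- against w(m - h) ≥ c (m/2)^s; otherwise w(m - h) ≥ c δ^s and the bound w ≤ M is enough.
    rcases le_or_gt (m / 2) δ with hmδ | hmδ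
    · have h1 := hdiff (c * (m / 2) ^ s) (by positivity) (hge (m / 2) (by positivity)
        (by linarith) hmδ)
      have h2 := hT w M A 0 hw.continuous hw.bounded hw.even hA.le le_rfl
        (fun y => by rw [abs_of_nonneg (hw.nonneg y), add_zero]; exact hup y) m h hh (by linarith)
      rw [add_zero] at h2
      have h3 : |w (m + h) - w (m - h)| ≤ C₂ * h ^ s := by
        have hpos : 0 < c * (m / 2) ^ s := by positivity
        refine le_of_mul_le_mul_right (h1.trans ?_) hpos
        have : C₂ * h ^ s * (c * (m / 2) ^ s) = 2 * (C * (A * m ^ s) * h ^ s) := by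
          rw [hC₂, Real.div_rpow hmpos.le (by norm_num)]
          field_simp
        linarith
      exact h3.trans (by gcongr; linarith)
    · have h1 := hdiff (c * δ ^ s) (by positivity) (hge δ hδ (by linarith) le_rfl)
      have h2 := hT w M 0 M hw.continuous hw.bounded hw.even le_rfl hM
        (fun y => by rw [zero_mul, zero_add]; exact hw.bounded y) m h hh (by linarith)
      rw [zero_mul, zero_add] at h2
      have h3 : |w (m + h) - w (m - h)| ≤ C₃ * h ^ s := by
        have hpos : 0 < c * δ ^ s := by positivity
        refine le_of_mul_le_mul_right (h1.trans ?_) hpos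
        have : C₃ * h ^ s * (c * δ ^ s) = 2 * (C * M * h ^ s) := by
          rw [hC₃]
          field_simp
        linarith
      exact h3.trans (by gcongr; linarith)

/-- Evenness and translation by the nearest multiple of the period bring the midpoint of any two
points into the region where w increases from the crest. -/
theorem IsCrestDefect.exists_holder [SFinite ν] (hs0 : 0 < s) (hs1 : s < 1)
    (hν : IsBesselMeasure s ν) (hw : IsCrestDefect ν w M) (hne : ∃ x, w x ≠ 0)
    (hmono : IsMonotoneFromCrest w) :
    ∃ C > 0, ∀ x y, |w x - w y| ≤ C * |x - y| ^ s := by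
  obtain ⟨C, hC, hS⟩ := hw.exists_abs_sub_le hs0 hs1 hν hne hmono
  have hreflect : ∀ m h, |w (|m| + h) - w (|m| - h)| = |w (m + h) - w (m - h)| := by
    intro m h
    rcases abs_cases m with ⟨e, -⟩ | ⟨e, -⟩
    · rw [e]
    · rw [e, ← hw.even (-m + h), ← hw.even (-m - h), abs_sub_comm]
      ring_nf
  have hmid : ∀ m h, 0 < h → |w (m + h) - w (m - h)| ≤ C * h ^ s := by
    intro m h hh
    rcases hmono with hm | ⟨p, hp, hper, hm⟩
    · rw [← hreflect]
      exact hS _ hm (fun x _ y hy _ => hy) |m| (abs_nonneg m) (abs_nonneg m) h hh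
    · have hr : |m - round (m / p) * p| ≤ p / 2 := by
        have h1 := abs_sub_round (m / p)
        calc |m - round (m / p) * p| = |m / p - round (m / p)| * p := by
              rw [← abs_of_pos hp, ← abs_mul, abs_of_pos hp]
              congr 1
              field_simp
          _ ≤ 1 / 2 * p := by gcongr
          _ = p / 2 := by ring
      have e1 : w (m + h) = w (m - round (m / p) * p + h) := by
        rw [← hper.sub_int_mul_eq (round (m / p))]
        ring_nf
      have e2 : w (m - h) = w (m - round (m / p) * p - h) := by
        rw [← hper.sub_int_mul_eq (round (m / p))]
        ring_nf
      rw [e1, e2, ← hreflect]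
      exact hS _ hm (fun x hx y hy hyx => ⟨hy, hyx.trans hx.2⟩) _ ⟨abs_nonneg _, hr⟩
        (abs_nonneg _) h hh
  have hlt : ∀ x y, y < x → |w x - w y| ≤ C * |x - y| ^ s := by
    intro x y hxy
    have h := hmid ((x + y) / 2) ((x - y) / 2) (by linarith)
    rw [show (x + y) / 2 + (x - y) / 2 = x by ring, show (x + y) / 2 - (x - y) / 2 = y by ring] at h
    have hpos : 0 < x - y := by linarith
    rw [abs_of_pos hpos]
    refine h.trans ?_
    gcongr
    linarith
  refine ⟨C, hC, fun x y => ?_⟩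
  rcases lt_trichotomy x y with h | h | h
  · rw [abs_sub_comm, abs_sub_comm x]; exact hlt y x h
  · subst h
    rw [sub_self, abs_zero]
    positivity
  · exact hlt x y h

end Holder

/-! ### From the solution to its crest defect, and sharpness of the exponent -/

section Wave

variable {s μ : ℝ} {ν : Measure ℝ} {φ : ℝ →ᵇ ℝ}

/-- The kernel has integral 1, so T(μ - φ) = μ - Tφ; the quadratic identity is twice the equation at
x minus twice the equation at 0. -/
theorem IsSolution.isCrestDefect [SFinite ν] (hν : IsBesselMeasure s ν) (hsol : IsSolution s μ φ)
    (hle : ∀ x, φ x ≤ μ) (heven : Function.Even φ) (hcrest : φ 0 = μ) :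
    IsCrestDefect ν (fun x => μ - φ x) (|μ| + ‖φ‖) where
  continuous := by fun_prop
  bounded y := (abs_sub _ _).trans (by gcongr; exact φ.norm_coe_le_norm y)
  even x := by simp only [heven x]
  nonneg y := sub_nonneg.2 (hle y)
  sq_eq x := by
    have hT : ∀ z, expOp ν (fun x => μ - φ x) z = μ - expOp ν φ z := by
      intro z
      have hi := (integrable_expKernel hν).comp_sub_left z
      simp only [expOp, mul_sub]
      rw [integral_sub (hi.mul_const μ)
        (integrable_expKernel_mul hν φ.continuous φ.norm_coe_le_norm z), integral_mul_const,
        integral_sub_left_eq_self (expKernel ν) volume z, integral_expKernel hν, one_mul]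
    have h1 := hsol.pointwise hν x
    have h0 := hsol.pointwise hν 0
    rw [hcrest] at h0
    rw [hT, hT]
    linear_combination 2 * h1 - 2 * h0

/-- Monotonicity is given on an open interval only. The endpoint 0 is covered by φ ≤ μ = φ(0), and
the trough P/2 by continuity. -/
theorem isMonotoneFromCrest_sub {P : ℝ≥0∞} (hP : 0 < P) (hle : ∀ x, φ x ≤ μ)
    (heven : Function.Even φ) (hper : IsPeriodic P φ) (hmono : MonotoneOn φ (leftHalf P))
    (hcrest : φ 0 = μ) : IsMonotoneFromCrest fun x => μ - φ x := by
  have hstep : ∀ x y : ℝ, 0 ≤ x → x ≤ y → (y = x ∨ ENNReal.ofReal y < P / 2) →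
      μ - φ x ≤ μ - φ y := by
    intro x y hx hxy hy
    rcases hx.eq_or_lt with rfl | hx0
    · rw [hcrest, sub_self]; exact sub_nonneg.2 (hle y)
    · rcases hy with rfl | hy
      · exact le_rfl
      · rw [← heven x, ← heven y]
        refine sub_le_sub_left (hmono ⟨by linarith, by rwa [neg_neg]⟩ ⟨by linarith, ?_⟩
          (by linarith)) μ
        rw [neg_neg]
        exact (ENNReal.ofReal_le_ofReal hxy).trans_lt hy
  rcases eq_or_ne P ∞ with rfl | hPtop
  · refine Or.inl fun x hx y _ hxy => hstep x y hx hxy (Or.inr ?_)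
    rw [ENNReal.top_div_of_ne_top (by simp)]
    exact ENNReal.ofReal_lt_top
  · have hp : 0 < P.toReal := ENNReal.toReal_pos hP.ne' hPtop
    have hlt : ∀ y, y < P.toReal / 2 → ENNReal.ofReal y < P / 2 := by
      intro y hy
      rw [← ENNReal.ofReal_toReal hPtop, ← ENNReal.ofReal_ofNat 2,
        ← ENNReal.ofReal_div_of_pos two_pos]
      exact (ENNReal.ofReal_lt_ofReal_iff (by positivity)).2 hy
    refine Or.inr ⟨P.toReal, hp, fun x => by simp only [hper hPtop x], fun x hx y hy hxy => ?_⟩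
    rcases hxy.eq_or_lt with rfl | hxy'
    · exact le_rfl
    · have hcont : Continuous fun z => μ - φ z := by fun_prop
      refine ge_of_tendsto ((hcont.tendsto y).mono_left (nhdsWithin_le_nhds (s := Set.Iio y))) ?_
      filter_upwards [Ioo_mem_nhdsLT hxy'] with z hz
      exact hstep x z hx.1 hz.1.le (Or.inr (hlt z (hz.2.trans_le hy.2)))

/-- A function whose defect at `0` is bounded below by `c |x| ^ s` has no Hölder regularity beyond
`s` there. -/
theorem not_isHolderAt_of_rpow_le {f : ℝ → ℝ} {c δ β : ℝ} (hc : 0 < c) (hδ : 0 < δ) (hβ : s < β)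
    (h : ∀ x, |x| < δ → c * |x| ^ s ≤ |f x - f 0|) : ¬ IsHolderAt β f 0 := by
  rintro ⟨C, δ', hδ', hC⟩
  -- Exponent β at 0 would force c ≤ C x^(β - s) for small x > 0, and the right side tends to 0.
  have hlim : Filter.Tendsto (fun x : ℝ => C * x ^ (β - s)) (nhdsWithin 0 (Set.Ioi 0))
      (nhds (C * 0)) := by
    refine Filter.Tendsto.const_mul C ?_
    have := (Real.continuousAt_rpow_const 0 (β - s) (Or.inr (by linarith))).tendsto
    rw [Real.zero_rpow (by linarith)] at this
    exact this.mono_left nhdsWithin_le_nhds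
  rw [mul_zero] at hlim
  refine absurd (ge_of_tendsto hlim ?_) (not_le.2 hc)
  filter_upwards [Ioo_mem_nhdsGT (lt_min hδ hδ')] with x hx
  have habs : |x| = x := abs_of_pos hx.1
  have h1 := h x (by rw [habs]; exact hx.2.trans_le (min_le_left _ _))
  have h2 := hC x (by rw [sub_zero, habs]; exact hx.2.trans_le (min_le_right _ _))
  rw [sub_zero, habs] at h2
  rw [habs] at h1
  have hxs : 0 < x ^ s := Real.rpow_pos_of_pos hx.1 s
  rw [Real.rpow_sub hx.1, mul_div_assoc', le_div_iff₀ hxs]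
  exact h1.trans h2

end Wave

end SteadyFKdV

theorem theorem3p8 (s : ℝ) (hs0 : 0 < s) (hs1 : s < 1) (P : ℝ≥0∞) (hP : 0 < P)
    (μ : ℝ) (φ : ℝ →ᵇ ℝ)
    (hsol : SteadyFKdV.IsSolution s μ φ)
    (hle : ∀ x, φ x ≤ μ)
    (heven : Function.Even φ)
    (hper : SteadyFKdV.IsPeriodic P φ)
    (hnonconst : ¬ ∃ c : ℝ, ∀ x, φ x = c)
    (hmono : MonotoneOn φ (SteadyFKdV.leftHalf P))
    (hcrest : φ 0 = μ) :
    SteadyFKdV.MemHolderSpace s φ ∧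
    (∃ c > 0, ∃ C > 0, ∃ δ > 0, ∀ x : ℝ, |x| < δ →
      c * |x| ^ s ≤ μ - φ x ∧ μ - φ x ≤ C * |x| ^ s) ∧
    (∀ β : ℝ, s < β → ¬ SteadyFKdV.IsHolderAt β φ 0) := by
  have hν := SteadyFKdV.isBesselMeasure_besselMeasure hs0 hs1
  have hw := hsol.isCrestDefect hν hle heven hcrest
  have hm := SteadyFKdV.isMonotoneFromCrest_sub hP hle heven hper hmono hcrest
  have hne : ∃ x, μ - φ x ≠ 0 := by
    by_contra! h
    exact hnonconst ⟨μ, fun x => by linarith [h x]⟩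
  obtain ⟨A, hA, hup⟩ := hw.exists_le_rpow hs0 hs1 hν
  obtain ⟨c, hc, δ, hδ, hlow⟩ := hw.exists_rpow_le hs0 hν hne hm
  obtain ⟨L, hL, hhol⟩ := hw.exists_holder hs0 hs1 hν hne hm
  have hholder : ∀ x y, |φ x - φ y| ≤ L * |x - y| ^ s := by
    intro x y
    have h := hhol x y
    rwa [sub_sub_sub_cancel_left, abs_sub_comm] at h
  refine ⟨⟨?_, ⟨‖φ‖, φ.norm_coe_le_norm⟩, L, hholder⟩,
    ⟨c, hc, A, hA, δ, hδ, fun x hx => ⟨hlow x hx.le, hup x⟩⟩, fun β hβ => ?_⟩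
  · refine Metric.uniformContinuous_iff.2 fun ε hε =>
      ⟨(ε / L) ^ s⁻¹, by positivity, fun x y hxy => ?_⟩
    rw [Real.dist_eq] at hxy ⊢
    have h := (Real.lt_rpow_inv_iff_of_pos (abs_nonneg _) (by positivity) hs0).1 hxy
    rw [lt_div_iff₀' hL] at h
    exact (hholder x y).trans_lt h
  · refine SteadyFKdV.not_isHolderAt_of_rpow_le hc hδ hβ fun x hx => ?_
    rw [hcrest, abs_sub_comm]
    exact (hlow x hx.le).trans (le_abs_self _)
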